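/- Let $\mathcal L$ be a lattice without boundaries, i.e. a finite cell decomposition (vertices $V$, edges $E$, faces $F$) of a closed surface, not necessarily connected or orientable. Assume that $\mathcal L$ is 3-valent (at each vertex there are exactly three ends of edges) and that its faces are colored with three colors $A,B,C$ so that the two faces along any edge have different colors; an edge between faces of colors $B$ and $C$ is called a $BC$ edge, etc. The color code has one qubit on each vertex of $\mathcal L$, and its stabilizer group $CC(\mathcal L)$ is generated by $X(f)=\bigotimes_{v\in f}X(v)$ and $Z(f)=\bigotimes_{v\in f}Z(v)$ for all faces $f$. The toric code on a lattice $\mathcal M$ without boundaries has one qubit on each edge, and its stabilizer group $TC(\mathcal M)$ is generated by $X(v)=\prod_{e\ni v}X(e)$ for all vertices $v$ and $Z(f)=\prod_{e\subset f}Z(e)$ for all faces $f$, where incidences are counted with multiplicity (a loop $e$ at $v$ contributes $X(e)^2=1$). Let $\mathcal L_A$ be the lattice obtained from $\mathcal L$ by shrinking the faces of color $A$ to points: its vertices are the $A$ faces of $\mathcal L$, its edges are the $BC$ edges of $\mathcal L$ (each joining the $A$ faces at its two ends), and its faces are the $B$ and $C$ faces of $\mathcal L$. Let $\mathcal L_B$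 be obtained in the same way by shrinking the faces of color $B$; its edges are the $AC$ edges of $\mathcal L$. Then there is, for each face $f$ of color $C$, a Clifford unitary $U_f$ (a unitary that maps Pauli operators to Pauli operators by conjugation) from the Hilbert space of the qubits on the vertices of $f$ to the Hilbert space of the qubits on the edges of $f$, such that $$U=\bigotimes_{f\text{ of color }C}U_f,$$ which maps the Hilbert space of the qubits on all vertices of $\mathcal L$ to that of the qubits on the edges of $\mathcal L_A$ and of $\mathcal L_B$, is a Clifford unitary and satisfies $$U\,[CC(\mathcal L)]\,U^\dagger=TC(\mathcal L_A)\otimes TC(\mathcal L_B),$$ where $TC(\mathcal L_A)\otimes TC(\mathcal L_B)=\{S\otimes T: S\in TC(\mathcal L_A),\ T\in TC(\mathcal L_B)\}$. -/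

import Mathlib

noncomputable section

namespace ColorCode

/-! ### Lattices on closed surfaces -/

/-- `b` is obtained from `a` by finitely many moves, each of them `s` or `t`.  (For involutions
`s`, `t` this says that `a` and `b` lie in the same orbit of the group generated by `s`, `t`.) -/
def SameOrbit {Φ : Type*} (s t : Φ → Φ) (a b : Φ) : Prop :=
  Relation.ReflTransGen (fun x y => y = s x ∨ y = t x) a b

/-- A lattice without boundary: a cell decomposition, with vertices `V`, edges `E`, faces `F`, of a
surface without boundary (not necessarily connected or orientable; compact if `Φ` is finite).
It is described by its set `Φ` of flags.  A flag is a triangle of the barycentric subdivision: it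
sits at one end of one edge, on one of the two sides of this edge, and belongs to a vertex, an edge
and a face.  The involution `τ i` passes to the neighboring triangle across the side opposite to
the corner of dimension `i`, so it keeps the cells of the other two dimensions: `τ0` moves to the other end of the edge, `τ2` moves to the
other side of the edge, and `τ1` moves to the other edge in the same corner of the face.
Each edge thus carries exactly four flags.  Vertices, edges and faces are the orbits under the moves
that keep the corner of dimension `0`, `1`, `2` respectively.  Loops, multiple edges and faces with
few edges are allowed. -/
structure Lattice (V E F Φ : Type*) where
  τ0 : Φ → Φ
  τ1 : Φ → Φ
  τ2 : Φ → Φ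
  τ0_τ0 : ∀ φ, τ0 (τ0 φ) = φ
  τ1_τ1 : ∀ φ, τ1 (τ1 φ) = φ
  τ2_τ2 : ∀ φ, τ2 (τ2 φ) = φ
  τ0_ne : ∀ φ, τ0 φ ≠ φ
  τ1_ne : ∀ φ, τ1 φ ≠ φ
  τ2_ne : ∀ φ, τ2 φ ≠ φ
  τ0_τ2 : ∀ φ, τ0 (τ2 φ) = τ2 (τ0 φ)
  τ0_ne_τ2 : ∀ φ, τ0 φ ≠ τ2 φ
  vert : Φ → V
  edge : Φ → E
  face : Φ → F
  vert_surj : Function.Surjective vert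
  edge_surj : Function.Surjective edge
  face_surj : Function.Surjective face
  vert_eq_iff : ∀ φ ψ, vert φ = vert ψ ↔ SameOrbit τ1 τ2 φ ψ
  edge_eq_iff : ∀ φ ψ, edge φ = edge ψ ↔ SameOrbit τ0 τ2 φ ψ
  face_eq_iff : ∀ φ ψ, face φ = face ψ ↔ SameOrbit τ0 τ1 φ ψ

/-- The three colors. -/
inductive Color
  | A
  | B
  | C
  deriving DecidableEq

namespace Lattice

variable {V E F Φ : Type*}

/-- Every vertex belongs to exactly three edges, counted as ends of edges: there are two flags at
each end of an edge, one on each side. -/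
def ThreeValent (L : Lattice V E F Φ) : Prop :=
  ∀ v : V, Nat.card {φ : Φ // L.vert φ = v} = 2 * 3

/-- The two faces on the two sides of any edge have different colors. -/
def ProperColoring (L : Lattice V E F Φ) (col : F → Color) : Prop :=
  ∀ φ : Φ, col (L.face φ) ≠ col (L.face (L.τ2 φ))

/-- The edge `e` does not lie on a face of color `c`.  For a proper coloring, this says that the two
faces along `e` have the two colors different from `c`; e.g. for `c = A`, that `e` is a `BC` edge. -/
def Avoids (L : Lattice V E F Φ) (col : F → Color) (c : Color) (e : E) : Prop :=
  ∀ φ : Φ, L.edge φ = e → col (L.face φ) ≠ c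

/-- The vertices of the face `f`. -/
def faceVerts (L : Lattice V E F Φ) (f : F) : Set V :=
  {v | ∃ φ, L.vert φ = v ∧ L.face φ = f}

/-- The edges of the face `f`. -/
def faceEdges (L : Lattice V E F Φ) (f : F) : Set E :=
  {e | ∃ φ, L.edge φ = e ∧ L.face φ = f}

/-- The coboundary of the vertex `v` modulo 2: the edges with exactly one end at `v`. -/
def coboundary (L : Lattice V E F Φ) (v : V) : Set E :=
  {e | ∃ φ, L.edge φ = e ∧ L.vert φ = v ∧ L.vert (L.τ0 φ) ≠ v}

/-- The boundary of the face `f` modulo 2: the edges with exactly one side on `f`. -/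
def boundary (L : Lattice V E F Φ) (f : F) : Set E :=
  {e | ∃ φ, L.edge φ = e ∧ L.face φ = f ∧ L.face (L.τ2 φ) ≠ f}

/-! ### Facts needed to see that the shrunk lattice is a lattice -/

section Facts

variable (L : Lattice V E F Φ)

lemma vert_τ1 (φ : Φ) : L.vert (L.τ1 φ) = L.vert φ :=
  ((L.vert_eq_iff _ _).2 (Relation.ReflTransGen.single (Or.inl rfl))).symm

lemma vert_τ2 (φ : Φ) : L.vert (L.τ2 φ) = L.vert φ :=
  ((L.vert_eq_iff _ _).2 (Relation.ReflTransGen.single (Or.inr rfl))).symm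

lemma edge_τ0 (φ : Φ) : L.edge (L.τ0 φ) = L.edge φ :=
  ((L.edge_eq_iff _ _).2 (Relation.ReflTransGen.single (Or.inl rfl))).symm

lemma edge_τ2 (φ : Φ) : L.edge (L.τ2 φ) = L.edge φ :=
  ((L.edge_eq_iff _ _).2 (Relation.ReflTransGen.single (Or.inr rfl))).symm

lemma face_τ0 (φ : Φ) : L.face (L.τ0 φ) = L.face φ :=
  ((L.face_eq_iff _ _).2 (Relation.ReflTransGen.single (Or.inl rfl))).symm

lemma face_τ1 (φ : Φ) : L.face (L.τ1 φ) = L.face φ :=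
  ((L.face_eq_iff _ _).2 (Relation.ReflTransGen.single (Or.inr rfl))).symm

variable {L}

lemma card_le_of_closed (h3 : L.ThreeValent) (φ : Φ) (T : Finset Φ) (hφ : φ ∈ T)
    (h1 : ∀ x ∈ T, L.τ1 x ∈ T) (h2 : ∀ x ∈ T, L.τ2 x ∈ T) : 6 ≤ T.card := by
  have hsub : ∀ x, L.vert x = L.vert φ → x ∈ T := by
    intro x hx
    have h := (L.vert_eq_iff φ x).1 hx.symm
    unfold SameOrbit at h
    induction h with
    | refl => exact hφ
    | @tail b c hb hstep ih =>
      have hbv : L.vert b = L.vert φ := ((L.vert_eq_iff φ b).2 hb).symm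
      rcases hstep with rfl | rfl
      · exact h1 _ (ih hbv)
      · exact h2 _ (ih hbv)
  have h6 := h3 (L.vert φ)
  have := Nat.card_le_card_of_injective
    (fun x : {x : Φ // L.vert x = L.vert φ} => (⟨x.1, hsub x.1 x.2⟩ : T))
    (fun a b hab => Subtype.ext (by simpa using hab))
  rw [h6] at this
  simpa using this

lemma le_card_of_subset (h3 : L.ThreeValent) (φ : Φ) (T : Finset Φ)
    (hT : ∀ x ∈ T, L.vert x = L.vert φ) : T.card ≤ 6 := by
  have h6 := h3 (L.vert φ)
  have : Finite {x : Φ // L.vert x = L.vert φ} := Nat.finite_of_card_ne_zero (by omega)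
  have := Nat.card_le_card_of_injective
    (fun x : T => (⟨x.1, hT x.1 x.2⟩ : {x : Φ // L.vert x = L.vert φ}))
    (fun a b hab => Subtype.ext (by simpa using hab))
  rw [h6] at this
  simpa using this

/-- Around a 3-valent vertex, three rotations return to the start. -/
lemma braid (h3 : L.ThreeValent) (φ : Φ) :
    L.τ2 (L.τ1 (L.τ2 φ)) = L.τ1 (L.τ2 (L.τ1 φ)) := by
  classical
  by_contra hne
  have e1 := L.τ1_τ1
  have e2 := L.τ2_τ2
  have n1 := L.τ1_ne
  have n2 := L.τ2_ne
  have hA : L.τ2 φ ≠ L.τ1 φ := by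
    intro h
    have := card_le_of_closed h3 φ {φ, L.τ1 φ} (by simp)
      (by simp only [Finset.mem_insert, Finset.mem_singleton]; grind)
      (by simp only [Finset.mem_insert, Finset.mem_singleton]; grind)
    have := Finset.card_le_two (a := φ) (b := L.τ1 φ)
    omega
  have hB : L.τ1 (L.τ2 φ) ≠ L.τ2 (L.τ1 φ) := by
    intro h
    have := card_le_of_closed h3 φ {φ, L.τ1 φ, L.τ2 φ, L.τ1 (L.τ2 φ)} (by simp)
      (by simp only [Finset.mem_insert, Finset.mem_singleton]; grind)
      (by simp only [Finset.mem_insert, Finset.mem_singleton]; grind)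
    have := Finset.card_le_four (a := φ) (b := L.τ1 φ) (c := L.τ2 φ) (d := L.τ1 (L.τ2 φ))
    omega
  have hle := le_card_of_subset h3 φ {φ, L.τ1 φ, L.τ2 φ, L.τ1 (L.τ2 φ), L.τ2 (L.τ1 φ),
      L.τ2 (L.τ1 (L.τ2 φ)), L.τ1 (L.τ2 (L.τ1 φ))} (by
    simp only [Finset.mem_insert, Finset.mem_singleton]
    rintro x (rfl | rfl | rfl | rfl | rfl | rfl | rfl) <;> simp only [vert_τ1, vert_τ2])
  have hcard : ({φ, L.τ1 φ, L.τ2 φ, L.τ1 (L.τ2 φ), L.τ2 (L.τ1 φ),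
      L.τ2 (L.τ1 (L.τ2 φ)), L.τ1 (L.τ2 (L.τ1 φ))} : Finset Φ).card = 7 := by
    repeat rw [Finset.card_insert_of_notMem (by
      simp only [Finset.mem_insert, Finset.mem_singleton]; grind)]
    simp
  omega

variable {col : F → Color}

/-- The three faces around a vertex have three different colors. -/
lemma third_ne (h3 : L.ThreeValent) (hc : L.ProperColoring col) (φ : Φ) :
    col (L.face (L.τ2 φ)) ≠ col (L.face (L.τ2 (L.τ1 φ))) := by
  have h := hc (L.τ1 (L.τ2 φ))
  rw [braid h3, L.face_τ1, L.face_τ1] at h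
  exact h

lemma avoids_iff (c : Color) (φ : Φ) : L.Avoids col c (L.edge φ) ↔
    col (L.face φ) ≠ c ∧ col (L.face (L.τ2 φ)) ≠ c := by
  constructor
  · intro h
    exact ⟨h φ rfl, h _ (L.edge_τ2 φ)⟩
  · rintro ⟨h1, h2⟩ ψ hψ
    have h := (L.edge_eq_iff φ ψ).1 hψ.symm
    have key : ∀ ψ, SameOrbit L.τ0 L.τ2 φ ψ →
        col (L.face ψ) ≠ c ∧ col (L.face (L.τ2 ψ)) ≠ c := by
      intro ψ h
      unfold SameOrbit at h
      induction h with
      | refl => exact ⟨h1, h2⟩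
      | tail _ hstep ih =>
        rcases hstep with rfl | rfl
        · rw [← L.τ0_τ2, L.face_τ0, L.face_τ0]; exact ih
        · rw [L.τ2_τ2]; exact ih.symm
    exact (key ψ h).1

lemma color_three {x y z c : Color} (hxy : x ≠ y) (hxz : x ≠ z) (hyz : y ≠ z) :
    (x ≠ c ∧ y ≠ c) ↔ z = c := by
  cases x <;> cases y <;> cases z <;> cases c <;> simp_all

/-- The edge of `φ` avoids the color `c` iff the third face at its vertex has color `c`. -/
lemma avoids_iff_third (h3 : L.ThreeValent) (hc : L.ProperColoring col) (c : Color) (φ : Φ) :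
    L.Avoids col c (L.edge φ) ↔ col (L.face (L.τ2 (L.τ1 φ))) = c := by
  rw [avoids_iff]
  refine color_three (hc φ) ?_ (third_ne h3 hc φ)
  have := hc (L.τ1 φ)
  rwa [L.face_τ1] at this

lemma avoids_τ1_τ0_τ1 (h3 : L.ThreeValent) (hc : L.ProperColoring col) (c : Color) (φ : Φ)
    (h : L.Avoids col c (L.edge φ)) : L.Avoids col c (L.edge (L.τ1 (L.τ0 (L.τ1 φ)))) := by
  rw [avoids_iff_third h3 hc] at h ⊢
  rw [L.τ1_τ1, ← L.τ0_τ2, L.face_τ0]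
  exact h

/-- Exactly one of the two edges in a corner of a face of color different from `c` avoids `c`. -/
lemma avoids_τ1_iff (h3 : L.ThreeValent) (hc : L.ProperColoring col) (c : Color) (φ : Φ)
    (h : col (L.face φ) ≠ c) :
    L.Avoids col c (L.edge (L.τ1 φ)) ↔ ¬ L.Avoids col c (L.edge φ) := by
  rw [avoids_iff_third h3 hc, L.τ1_τ1, avoids_iff]
  tauto

end Facts

/-- The lattice obtained from a properly colored 3-valent lattice by shrinking the faces of color
`c`.  Its vertices are the faces of color `c`, its edges are the edges whose two faces have the two
colors different from `c`, and its faces are the faces of the two colors different from `c`.  The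
flags of the shrunk lattice are the flags of `L` on the edges that survive; the vertex of such a
flag is the face of color `c` at the corresponding end of the edge.  In a face, the next edge is
found by passing along one edge that is shrunk to a point. -/
def shrink (L : Lattice V E F Φ) (col : F → Color) (h3 : L.ThreeValent)
    (hc : L.ProperColoring col) (c : Color) :
    Lattice {f : F // col f = c} {e : E // L.Avoids col c e} {f : F // col f ≠ c}
      {φ : Φ // L.Avoids col c (L.edge φ)} where
  τ0 φ := ⟨L.τ0 φ.1, by rw [L.edge_τ0]; exact φ.2⟩
  τ1 φ := ⟨L.τ1 (L.τ0 (L.τ1 φ.1)), avoids_τ1_τ0_τ1 h3 hc c φ.1 φ.2⟩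
  τ2 φ := ⟨L.τ2 φ.1, by rw [L.edge_τ2]; exact φ.2⟩
  τ0_τ0 φ := Subtype.ext (L.τ0_τ0 _)
  τ1_τ1 φ := Subtype.ext (by simp only [L.τ1_τ1, L.τ0_τ0])
  τ2_τ2 φ := Subtype.ext (L.τ2_τ2 _)
  τ0_ne φ h := L.τ0_ne _ (congrArg Subtype.val h)
  τ1_ne φ h := by
    have h' := congrArg L.τ1 (congrArg Subtype.val h)
    simp only [L.τ1_τ1] at h'
    exact L.τ0_ne _ h'
  τ2_ne φ h := L.τ2_ne _ (congrArg Subtype.val h)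
  τ0_τ2 φ := Subtype.ext (L.τ0_τ2 _)
  τ0_ne_τ2 φ h := L.τ0_ne_τ2 _ (congrArg Subtype.val h)
  vert φ := ⟨L.face (L.τ2 (L.τ1 φ.1)), (avoids_iff_third h3 hc c φ.1).1 φ.2⟩
  edge φ := ⟨L.edge φ.1, φ.2⟩
  face φ := ⟨L.face φ.1, φ.2 φ.1 rfl⟩
  vert_surj := by
    rintro ⟨f, hf⟩
    obtain ⟨χ, rfl⟩ := L.face_surj f
    refine ⟨⟨L.τ1 (L.τ2 χ), ?_⟩, ?_⟩
    · rw [avoids_iff_third h3 hc, L.τ1_τ1, L.τ2_τ2]; exact hf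
    · simp only [L.τ1_τ1, L.τ2_τ2]
  edge_surj := by
    rintro ⟨e, he⟩
    obtain ⟨χ, rfl⟩ := L.edge_surj e
    exact ⟨⟨χ, he⟩, rfl⟩
  face_surj := by
    rintro ⟨f, hf⟩
    obtain ⟨χ, rfl⟩ := L.face_surj f
    by_cases h : L.Avoids col c (L.edge χ)
    · exact ⟨⟨χ, h⟩, rfl⟩
    · exact ⟨⟨L.τ1 χ, (avoids_τ1_iff h3 hc c χ hf).2 h⟩, Subtype.ext (L.face_τ1 χ)⟩
  vert_eq_iff := by
    intro φ ψ
    constructor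
    · intro h
      have h' := (L.face_eq_iff _ _).1 (congrArg Subtype.val h)
      have key : ∀ χ, SameOrbit L.τ0 L.τ1 (L.τ2 (L.τ1 φ.1)) χ →
          ∀ ω : {φ : Φ // L.Avoids col c (L.edge φ)}, L.τ2 (L.τ1 ω.1) = χ →
          Relation.ReflTransGen (fun x y : {φ : Φ // L.Avoids col c (L.edge φ)} =>
            y = ⟨L.τ1 (L.τ0 (L.τ1 x.1)), avoids_τ1_τ0_τ1 h3 hc c x.1 x.2⟩ ∨
            y = ⟨L.τ2 x.1, by rw [L.edge_τ2]; exact x.2⟩) φ ω := by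
        intro χ hχ
        unfold SameOrbit at hχ
        induction hχ with
        | refl =>
          intro ω hω
          have : ω = φ := Subtype.ext (by
            have := congrArg L.τ1 (congrArg L.τ2 hω)
            simpa only [L.τ1_τ1, L.τ2_τ2] using this)
          rw [this]
        | @tail a b _ hstep ih =>
          intro ω hω
          rcases hstep with hb | hb
          · refine (ih ⟨L.τ1 (L.τ0 (L.τ1 ω.1)), avoids_τ1_τ0_τ1 h3 hc c ω.1 ω.2⟩ ?_).tail
              (Or.inl ?_)
            · simp only [L.τ1_τ1]
              rw [← L.τ0_τ2, hω, hb, L.τ0_τ0]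
            · exact Subtype.ext (by simp only [L.τ1_τ1, L.τ0_τ0])
          · refine (ih ⟨L.τ2 ω.1, by rw [L.edge_τ2]; exact ω.2⟩ ?_).tail (Or.inr ?_)
            · rw [braid h3, hω, hb, L.τ1_τ1]
            · exact Subtype.ext (L.τ2_τ2 _).symm
      exact key _ h' ψ rfl
    · intro h
      unfold SameOrbit at h
      induction h with
      | refl => rfl
      | tail _ hstep ih =>
        rw [ih]
        rcases hstep with rfl | rfl
        · refine Subtype.ext ?_
          simp only [L.τ1_τ1]
          rw [← L.τ0_τ2, L.face_τ0]
        · refine Subtype.ext ?_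
          simp only
          rw [braid h3, L.face_τ1]
  edge_eq_iff := by
    intro φ ψ
    constructor
    · intro h
      have h' := (L.edge_eq_iff _ _).1 (congrArg Subtype.val h)
      have key : ∀ χ, SameOrbit L.τ0 L.τ2 φ.1 χ →
          ∀ ω : {φ : Φ // L.Avoids col c (L.edge φ)}, ω.1 = χ →
          Relation.ReflTransGen (fun x y : {φ : Φ // L.Avoids col c (L.edge φ)} =>
            y = ⟨L.τ0 x.1, by rw [L.edge_τ0]; exact x.2⟩ ∨
            y = ⟨L.τ2 x.1, by rw [L.edge_τ2]; exact x.2⟩) φ ω := by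
        intro χ hχ
        unfold SameOrbit at hχ
        induction hχ with
        | refl =>
          intro ω hω
          rw [Subtype.ext hω]
        | @tail a b _ hstep ih =>
          intro ω hω
          rcases hstep with hb | hb
          · refine (ih ⟨L.τ0 ω.1, by rw [L.edge_τ0]; exact ω.2⟩ ?_).tail (Or.inl ?_)
            · change L.τ0 ω.1 = a
              rw [hω, hb, L.τ0_τ0]
            · exact Subtype.ext (L.τ0_τ0 _).symm
          · refine (ih ⟨L.τ2 ω.1, by rw [L.edge_τ2]; exact ω.2⟩ ?_).tail (Or.inr ?_)
            · change L.τ2 ω.1 = a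
              rw [hω, hb, L.τ2_τ2]
            · exact Subtype.ext (L.τ2_τ2 _).symm
      exact key _ h' ψ rfl
    · intro h
      unfold SameOrbit at h
      induction h with
      | refl => rfl
      | tail _ hstep ih =>
        rw [ih]
        rcases hstep with rfl | rfl
        · exact Subtype.ext (L.edge_τ0 _).symm
        · exact Subtype.ext (L.edge_τ2 _).symm
  face_eq_iff := by
    intro φ ψ
    constructor
    · intro h
      have h' := (L.face_eq_iff _ _).1 (congrArg Subtype.val h)
      have key : ∀ χ, SameOrbit L.τ0 L.τ1 φ.1 χ →
          ∀ ω : {φ : Φ // L.Avoids col c (L.edge φ)}, (ω.1 = χ ∨ L.τ1 ω.1 = χ) →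
          Relation.ReflTransGen (fun x y : {φ : Φ // L.Avoids col c (L.edge φ)} =>
            y = ⟨L.τ0 x.1, by rw [L.edge_τ0]; exact x.2⟩ ∨
            y = ⟨L.τ1 (L.τ0 (L.τ1 x.1)), avoids_τ1_τ0_τ1 h3 hc c x.1 x.2⟩) φ ω := by
        intro χ hχ
        unfold SameOrbit at hχ
        induction hχ with
        | refl =>
          rintro ω (hω | hω)
          · rw [Subtype.ext hω]
          · exfalso
            have h1 := φ.2
            rw [← hω, avoids_τ1_iff h3 hc c ω.1 (ω.2 ω.1 rfl)] at h1
            exact h1 ω.2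
        | @tail a b _ hstep ih =>
          rintro ω (hω | hω)
          · rcases hstep with hb | hb
            · refine (ih ⟨L.τ0 ω.1, by rw [L.edge_τ0]; exact ω.2⟩ (Or.inl ?_)).tail (Or.inl ?_)
              · change L.τ0 ω.1 = a
                rw [hω, hb, L.τ0_τ0]
              · exact Subtype.ext (L.τ0_τ0 _).symm
            · exact ih ω (Or.inr (by rw [hω, hb, L.τ1_τ1]))
          · rcases hstep with hb | hb
            · refine (ih ⟨L.τ1 (L.τ0 (L.τ1 ω.1)), avoids_τ1_τ0_τ1 h3 hc c ω.1 ω.2⟩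
                (Or.inr ?_)).tail (Or.inr ?_)
              · simp only [L.τ1_τ1]
                rw [hω, hb, L.τ0_τ0]
              · exact Subtype.ext (by simp only [L.τ1_τ1, L.τ0_τ0])
            · refine ih ω (Or.inl ?_)
              have := congrArg L.τ1 hω
              rwa [hb, L.τ1_τ1, L.τ1_τ1] at this
      exact key _ h' ψ (Or.inl rfl)
    · intro h
      unfold SameOrbit at h
      induction h with
      | refl => rfl
      | tail _ hstep ih =>
        rw [ih]
        rcases hstep with rfl | rfl
        · exact Subtype.ext (L.face_τ0 _).symm
        · refine Subtype.ext ?_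
          simp only [L.face_τ1, L.face_τ0]

end Lattice

/-! ### Qubits, Pauli operators and Clifford unitaries -/

/-- Linear maps from the Hilbert space of qubits labelled by `Q'` to the one of qubits labelled by
`Q`, as matrices with respect to the computational bases. -/
abbrev Op (Q Q' : Type*) := Matrix (Q → Fin 2) (Q' → Fin 2) ℂ

/-- The Pauli matrix `X`. -/
def σX : Matrix (Fin 2) (Fin 2) ℂ := !![0, 1; 1, 0]

/-- The Pauli matrix `Y`. -/
def σY : Matrix (Fin 2) (Fin 2) ℂ := !![0, -Complex.I; Complex.I, 0]

/-- The Pauli matrix `Z`. -/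
def σZ : Matrix (Fin 2) (Fin 2) ℂ := !![1, 0; 0, -1]

/-- The tensor product of the one-qubit operators `M q`. -/
def tensorPow {Q : Type*} [Fintype Q] (M : Q → Matrix (Fin 2) (Fin 2) ℂ) : Op Q Q :=
  Matrix.of fun x y => ∏ q, M q (x q) (y q)

open scoped Classical in
/-- The operator `P` on every qubit in the set `S`, the identity on the others. -/
def onSet {Q : Type*} [Fintype Q] (P : Matrix (Fin 2) (Fin 2) ℂ) (S : Set Q) : Op Q Q :=
  tensorPow fun q => if q ∈ S then P else 1

/-- The Pauli group: tensor products of Pauli matrices, with phases `1, i, -1, -i`. -/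
def pauliGroup (Q : Type*) [Fintype Q] : Set (Op Q Q) :=
  {M | ∃ (ω : ℂ) (P : Q → Matrix (Fin 2) (Fin 2) ℂ), ω ^ 4 = 1 ∧
    (∀ q, P q = 1 ∨ P q = σX ∨ P q = σY ∨ P q = σZ) ∧ M = ω • tensorPow P}

/-- `U` is a Clifford unitary from the space of the qubits `Q'` to the space of the qubits `Q`:
a unitary map that takes Pauli operators to Pauli operators by conjugation. -/
def IsClifford {Q Q' : Type*} [Fintype Q] [Fintype Q'] [DecidableEq Q] [DecidableEq Q']
    (U : Op Q Q') : Prop :=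
  U * U.conjTranspose = 1 ∧ U.conjTranspose * U = 1 ∧
    ∀ M ∈ pauliGroup Q', U * M * U.conjTranspose ∈ pauliGroup Q

section Generators

lemma tensorPow_one {Q : Type*} [Fintype Q] : tensorPow (fun _ : Q => (1 : Matrix (Fin 2) (Fin 2) ℂ)) = 1 := by
  ext x y
  simp only [tensorPow, Matrix.of_apply, Matrix.one_apply, Finset.prod_ite_zero, Finset.mem_univ,
    true_implies, Finset.prod_const_one, funext_iff]

variable {Q : Type*} [Fintype Q] [DecidableEq Q]

lemma tensorPow_mul (M N : Q → Matrix (Fin 2) (Fin 2) ℂ) :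
    tensorPow M * tensorPow N = tensorPow fun q => M q * N q := by
  ext x y
  simp only [tensorPow, Matrix.mul_apply, Matrix.of_apply]
  rw [Finset.prod_univ_sum, Fintype.piFinset_univ]
  simp only [Finset.prod_mul_distrib]

lemma onSet_mul_self {P : Matrix (Fin 2) (Fin 2) ℂ} (hP : P * P = 1) (S : Set Q) :
    onSet P S * onSet P S = 1 := by
  rw [onSet, tensorPow_mul, ← tensorPow_one]
  congr 1
  funext q
  split_ifs <;> simp [hP]

lemma σX_mul_self : σX * σX = 1 := by
  simp [σX, Matrix.one_fin_two]

lemma σZ_mul_self : σZ * σZ = 1 := by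
  simp [σZ, Matrix.one_fin_two]

/-- The operator `⨂_{q ∈ S} X(q)` as an invertible operator. -/
def XOn (S : Set Q) : (Op Q Q)ˣ :=
  ⟨onSet σX S, onSet σX S, onSet_mul_self σX_mul_self S, onSet_mul_self σX_mul_self S⟩

/-- The operator `⨂_{q ∈ S} Z(q)` as an invertible operator. -/
def ZOn (S : Set Q) : (Op Q Q)ˣ :=
  ⟨onSet σZ S, onSet σZ S, onSet_mul_self σZ_mul_self S, onSet_mul_self σZ_mul_self S⟩

end Generators

/-! ### The two codes -/

/-- The stabilizer group of the color code: qubits on vertices, `X` and `Z` generators on faces. -/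
def colorCode {V E F Φ : Type*} [Fintype V] [DecidableEq V] (L : Lattice V E F Φ) :
    Subgroup (Op V V)ˣ :=
  Subgroup.closure
    (Set.range (fun f : F => XOn (L.faceVerts f)) ∪ Set.range (fun f : F => ZOn (L.faceVerts f)))

/-- The stabilizer group of the toric code: qubits on edges, `X` generators on vertices, `Z`
generators on faces.  The generator of a vertex has one factor `X(e)` for each end of an edge `e` at
this vertex, so a loop contributes `X(e)² = 1`; similarly for a face which lies on both sides of an
edge. -/
def toricCode {V E F Φ : Type*} [Fintype E] [DecidableEq E] (L : Lattice V E F Φ) :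
    Subgroup (Op E E)ˣ :=
  Subgroup.closure
    (Set.range (fun v : V => XOn (L.coboundary v)) ∪ Set.range (fun f : F => ZOn (L.boundary f)))

/-- The operators in a group of invertible operators. -/
def ops {Q : Type*} [Fintype Q] [DecidableEq Q] (G : Subgroup (Op Q Q)ˣ) : Set (Op Q Q) :=
  {M | ∃ g ∈ G, (g : Op Q Q) = M}

/-- The tensor product of operators on two disjoint sets of qubits. -/
def tensor {Q R : Type*} (M : Op Q Q) (N : Op R R) : Op (Q ⊕ R) (Q ⊕ R) :=
  Matrix.of fun x y =>
    M (fun q => x (Sum.inl q)) (fun q => y (Sum.inl q)) *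
      N (fun r => x (Sum.inr r)) (fun r => y (Sum.inr r))

/-- The tensor product `G ⊗ H` of stabilizer groups on two disjoint sets of qubits. -/
def tensorGroup {Q R : Type*} [Fintype Q] [DecidableEq Q] [Fintype R] [DecidableEq R]
    (G : Subgroup (Op Q Q)ˣ) (H : Subgroup (Op R R)ˣ) : Set (Op (Q ⊕ R) (Q ⊕ R)) :=
  {T | ∃ M ∈ ops G, ∃ N ∈ ops H, T = tensor M N}

/-! ### Products of unitaries over the faces of one color -/

section Faces

variable {V E F Φ : Type*}

/-- The qubits of the two toric codes: the edges of the lattices obtained by shrinking the faces of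
color `A` and of color `B`, i.e. the `BC` edges and the `AC` edges. -/
abbrev ToricQubits (L : Lattice V E F Φ) (col : F → Color) :=
  {e : E // L.Avoids col Color.A e} ⊕ {e : E // L.Avoids col Color.B e}

/-- The edge that carries a qubit of the two toric codes. -/
def ToricQubits.edge {L : Lattice V E F Φ} {col : F → Color} : ToricQubits L col → E :=
  Sum.elim Subtype.val Subtype.val

/-- The qubits of the color code on the face `f`: its vertices. -/
abbrev VertsOn (L : Lattice V E F Φ) (f : F) := {v : V // v ∈ L.faceVerts f}

/-- The qubits of the two toric codes on the face `f`: those on its edges. -/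
abbrev EdgesOn (L : Lattice V E F Φ) (col : F → Color) (f : F) :=
  {q : ToricQubits L col // ToricQubits.edge q ∈ L.faceEdges f}

open scoped Classical in
/-- The tensor product `⨂_f U_f` over the faces `f` of color `C`, where `U_f` maps the space of the
qubits on the vertices of `f` to the space of the qubits on the edges of `f`. -/
def tensorOverC [Fintype F] (L : Lattice V E F Φ) (col : F → Color)
    (U : ∀ f : {f : F // col f = Color.C}, Op (EdgesOn L col f.1) (VertsOn L f.1)) :
    Op (ToricQubits L col) V :=
  Matrix.of fun x y => ∏ f, U f (fun q => x q.1) (fun v => y v.1)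

end Faces

end ColorCode

end

/-!
The vertices of a face of color `C` form an even cycle, whose edges are alternately `BC` edges
(edges of `L_A`) and `AC` edges (edges of `L_B`).  On each cycle, `U` maps a basis state `y` to
basis states in which the bit of an edge is the sum of the bits of `y` at its two ends.  This alone
is not invertible: it does not see a global flip of `y`, and the edge bits it produces have the same
parity on both kinds of edges.  Hence the bit of `y` at a root of the cycle is turned by a Hadamard
transform into the parity of the `BC` bits, and the bits of the two edges at the root are corrected
accordingly.

Up to products of `Z` along all the edges of one kind of a cycle, `U` then maps `X (f)`, for `f` of
color `A` or `B`, to a star operator of `L_A` or `L_B`, and `Z (f)` to the plaquette operator of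
`f`, while `X (f)` for `f` of color `C` becomes the product of `Z` along the `BC` edges of `f`.  The
extra factors are themselves plaquette operators, so the two stabilizer groups agree.
-/

noncomputable section

namespace ColorCode

open Matrix
open scoped Fin.CommRing

/-! ### Pauli operators labelled by binary vectors -/

section Bits

variable {Q : Type*}

lemma bits_add_self (s : Q → Fin 2) : s + s = 0 :=
  funext fun q => CharTwo.add_self_eq_zero (s q)

lemma bits_add_add_cancel (s t : Q → Fin 2) : s + t + t = s := by
  rw [add_assoc, bits_add_self, add_zero]

lemma bits_eq_add_iff {s t r : Q → Fin 2} : s = t + r ↔ t = s + r := by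
  constructor <;> rintro rfl <;> rw [bits_add_add_cancel]

end Bits

/-- The sign `(-1) ^ a` of a bit `a`, as an additive character. -/
def sgn : AddChar (Fin 2) ℂ where
  toFun a := (-1) ^ (a : ℕ)
  map_zero_eq_one' := pow_zero _
  map_add_eq_mul' a b := by fin_cases a <;> fin_cases b <;> simp

@[simp] lemma sgn_one : sgn 1 = -1 := pow_one _

lemma sgn_sum {ι : Type*} (s : Finset ι) (f : ι → Fin 2) :
    sgn (∑ i ∈ s, f i) = ∏ i ∈ s, sgn (f i) :=
  map_prod sgn.toMonoidHom (fun i => Multiplicative.ofAdd (f i)) s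

section PauliOperators

variable {Q R : Type*} [Fintype Q]

/-- The Pauli operator `⨂ X ^ s q`, which flips the bits where `s` is `1`. -/
def pauliX (s : Q → Fin 2) : Op Q Q := Matrix.of fun x y => if x = y + s then 1 else 0

/-- The Pauli operator `⨂ Z ^ r q`, which multiplies the basis vector `x` by `(-1) ^ (r ⬝ᵥ x)`. -/
def pauliZ (r : Q → Fin 2) : Op Q Q := Matrix.diagonal fun x => sgn (r ⬝ᵥ x)

lemma pauliX_eq_tensorPow (s : Q → Fin 2) : pauliX s = tensorPow fun q => σX ^ (s q : ℕ) := by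
  have hσX (a b c : Fin 2) : (σX ^ (c : ℕ)) a b = if a = b + c then 1 else 0 := by
    fin_cases a <;> fin_cases b <;> fin_cases c <;> simp [σX]
  ext x y
  simp only [pauliX, tensorPow, Matrix.of_apply, hσX, Finset.prod_ite_zero, Finset.prod_const_one,
    funext_iff, Pi.add_apply, Finset.mem_univ, true_implies]

lemma pauliZ_eq_tensorPow (r : Q → Fin 2) : pauliZ r = tensorPow fun q => σZ ^ (r q : ℕ) := by
  have hσZ (a b c : Fin 2) : (σZ ^ (c : ℕ)) a b = if a = b then sgn (c * a) else 0 := by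
    fin_cases a <;> fin_cases b <;> fin_cases c <;> simp [σZ]
  ext x y
  simp only [pauliZ, tensorPow, Matrix.of_apply, Matrix.diagonal_apply, hσZ, Finset.prod_ite_zero,
    funext_iff, Finset.mem_univ, true_implies, dotProduct, sgn_sum]

lemma onSet_eq_tensorPow (P : Matrix (Fin 2) (Fin 2) ℂ) (S : Set Q) :
    onSet P S = tensorPow fun q => P ^ ((S.indicator 1 q : Fin 2) : ℕ) := by
  refine congrArg tensorPow (funext fun q => ?_)
  by_cases hq : q ∈ S <;> simp [hq]

lemma onSet_σX (S : Set Q) : onSet σX S = pauliX (S.indicator 1) := by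
  rw [onSet_eq_tensorPow, pauliX_eq_tensorPow]

lemma onSet_σZ (S : Set Q) : onSet σZ S = pauliZ (S.indicator 1) := by
  rw [onSet_eq_tensorPow, pauliZ_eq_tensorPow]

@[simp] lemma pauliX_zero : pauliX (0 : Q → Fin 2) = 1 := by
  ext x y
  simp [pauliX, Matrix.one_apply]

@[simp] lemma pauliZ_zero : pauliZ (0 : Q → Fin 2) = 1 := by
  simp [pauliZ]

lemma tensorPow_smul (c : Q → ℂ) (P : Q → Matrix (Fin 2) (Fin 2) ℂ) :
    tensorPow (fun q => c q • P q) = (∏ q, c q) • tensorPow P := by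
  ext x y
  simp [tensorPow, Finset.prod_mul_distrib]

lemma pauliX_mem_pauliGroup (s : Q → Fin 2) : pauliX s ∈ pauliGroup Q := by
  refine ⟨1, _, one_pow 4, fun q => ?_, by rw [one_smul, pauliX_eq_tensorPow]⟩
  generalize s q = a
  fin_cases a <;> simp

lemma pauliZ_mem_pauliGroup (r : Q → Fin 2) : pauliZ r ∈ pauliGroup Q := by
  refine ⟨1, _, one_pow 4, fun q => ?_, by rw [one_smul, pauliZ_eq_tensorPow]⟩
  generalize r q = a
  fin_cases a <;> simp

lemma smul_mem_pauliGroup {M : Op Q Q} {c : ℂ} (hc : c ^ 4 = 1) (hM : M ∈ pauliGroup Q) :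
    c • M ∈ pauliGroup Q := by
  obtain ⟨ω, P, hω, hP, rfl⟩ := hM
  exact ⟨c * ω, P, by rw [mul_pow, hc, hω, one_mul], hP, smul_smul _ _ _⟩

variable [DecidableEq Q]

lemma pauliX_mul_apply (s : Q → Fin 2) (U : Op Q R) (x : Q → Fin 2) (y : R → Fin 2) :
    (pauliX s * U) x y = U (x + s) y := by
  simp [pauliX, Matrix.mul_apply, bits_eq_add_iff (s := x)]

lemma mul_pauliX_apply (s : Q → Fin 2) (U : Op R Q) (x : R → Fin 2) (y : Q → Fin 2) :
    (U * pauliX s) x y = U x (y + s) := by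
  simp [pauliX, Matrix.mul_apply]

lemma pauliZ_mul_apply (r : Q → Fin 2) (U : Op Q R) (x : Q → Fin 2) (y : R → Fin 2) :
    (pauliZ r * U) x y = sgn (r ⬝ᵥ x) * U x y :=
  Matrix.diagonal_mul _ _ _ _

lemma mul_pauliZ_apply (r : Q → Fin 2) (U : Op R Q) (x : R → Fin 2) (y : Q → Fin 2) :
    (U * pauliZ r) x y = U x y * sgn (r ⬝ᵥ y) :=
  Matrix.mul_diagonal _ _ _ _

lemma pauliX_add (s t : Q → Fin 2) : pauliX (s + t) = pauliX s * pauliX t := by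
  ext x y
  rw [pauliX_mul_apply]
  simp only [pauliX, Matrix.of_apply, bits_eq_add_iff (s := x), bits_eq_add_iff (s := x + s),
    add_assoc]

lemma pauliZ_add (r s : Q → Fin 2) : pauliZ (r + s) = pauliZ r * pauliZ s := by
  simp [pauliZ, add_dotProduct, AddChar.map_add_eq_mul]

lemma pauliX_mul_self (s : Q → Fin 2) : pauliX s * pauliX s = 1 := by
  rw [← pauliX_add, bits_add_self, pauliX_zero]

lemma pauliZ_mul_self (r : Q → Fin 2) : pauliZ r * pauliZ r = 1 := by
  rw [← pauliZ_add, bits_add_self, pauliZ_zero]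

lemma pauliZ_mul_pauliX (r s : Q → Fin 2) :
    pauliZ r * pauliX s = sgn (r ⬝ᵥ s) • (pauliX s * pauliZ r) := by
  ext x y
  rw [pauliZ_mul_apply, Matrix.smul_apply, mul_pauliZ_apply, pauliX, Matrix.of_apply]
  split_ifs with h
  · rw [h, dotProduct_add, AddChar.map_add_eq_mul, smul_eq_mul]
    ring
  · simp

lemma pauliX_mul_pauliZ_eq_tensorPow (s r : Q → Fin 2) :
    pauliX s * pauliZ r = tensorPow fun q => σX ^ (s q : ℕ) * σZ ^ (r q : ℕ) := by
  rw [pauliX_eq_tensorPow, pauliZ_eq_tensorPow, tensorPow_mul]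

lemma σX_mul_σZ : σX * σZ = -Complex.I • σY := by
  simp [σX, σY, σZ]

lemma σY_eq_smul : σY = Complex.I • (σX * σZ) := by
  simp [σX_mul_σZ, smul_smul]

lemma exists_eq_smul_pauliX_mul_pauliZ {M : Op Q Q} (hM : M ∈ pauliGroup Q) :
    ∃ (c : ℂ) (s r : Q → Fin 2), c ^ 4 = 1 ∧ M = c • (pauliX s * pauliZ r) := by
  obtain ⟨ω, P, hω, hP, rfl⟩ := hM
  have hP' (q : Q) : ∃ (c : ℂ) (a b : Fin 2), c ^ 4 = 1 ∧
      P q = c • (σX ^ (a : ℕ) * σZ ^ (b : ℕ)) := by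
    rcases hP q with h | h | h | h
    · exact ⟨1, 0, 0, one_pow 4, by simp [h]⟩
    · exact ⟨1, 1, 0, one_pow 4, by simp [h]⟩
    · exact ⟨Complex.I, 1, 1, Complex.I_pow_four, by simp [h, σY_eq_smul]⟩
    · exact ⟨1, 0, 1, one_pow 4, by simp [h]⟩
  choose c s r hc hcP using hP'
  refine ⟨ω * ∏ q, c q, s, r, ?_, ?_⟩
  · simp [mul_pow, hω, ← Finset.prod_pow, hc]
  · rw [pauliX_mul_pauliZ_eq_tensorPow, mul_smul, ← tensorPow_smul, funext hcP]

lemma smul_pauliX_mul_pauliZ_mem_pauliGroup {c : ℂ} (hc : c ^ 4 = 1) (s r : Q → Fin 2) :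
    c • (pauliX s * pauliZ r) ∈ pauliGroup Q := by
  have hI : (-Complex.I) ^ 4 = 1 := by rw [Even.neg_pow (by decide), Complex.I_pow_four]
  have h (a b : Fin 2) : ∃ (d : ℂ) (P : Matrix (Fin 2) (Fin 2) ℂ), d ^ 4 = 1 ∧
      (P = 1 ∨ P = σX ∨ P = σY ∨ P = σZ) ∧ σX ^ (a : ℕ) * σZ ^ (b : ℕ) = d • P := by
    fin_cases a <;> fin_cases b
    · exact ⟨1, 1, by simp⟩
    · exact ⟨1, σZ, by simp⟩
    · exact ⟨1, σX, by simp⟩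
    · exact ⟨-Complex.I, σY, hI, by simp, by simp [σX_mul_σZ]⟩
  choose d P hd hP hdP using h
  refine ⟨c * ∏ q, d (s q) (r q), fun q => P (s q) (r q), ?_, fun q => hP _ _, ?_⟩
  · simp [mul_pow, hc, ← Finset.prod_pow, hd]
  · simp only [pauliX_mul_pauliZ_eq_tensorPow, hdP, tensorPow_smul, mul_smul]

lemma mul_mem_pauliGroup {M N : Op Q Q} (hM : M ∈ pauliGroup Q) (hN : N ∈ pauliGroup Q) :
    M * N ∈ pauliGroup Q := by
  obtain ⟨c, s, r, hc, rfl⟩ := exists_eq_smul_pauliX_mul_pauliZ hM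
  obtain ⟨d, t, u, hd, rfl⟩ := exists_eq_smul_pauliX_mul_pauliZ hN
  have h : c • (pauliX s * pauliZ r) * d • (pauliX t * pauliZ u) =
      (c * d * sgn (r ⬝ᵥ t)) • (pauliX (s + t) * pauliZ (r + u)) :=
    calc _ = (c * d) • (pauliX s * (pauliZ r * pauliX t) * pauliZ u) := by
          simp only [smul_mul_smul_comm, Matrix.mul_assoc]
      _ = _ := by
          simp only [pauliZ_mul_pauliX, pauliX_add, pauliZ_add, Matrix.mul_smul, Matrix.smul_mul,
            smul_smul, Matrix.mul_assoc]
  have hsgn (a : Fin 2) : sgn a ^ 4 = 1 := by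
    fin_cases a <;> simp [Even.neg_pow (by decide : Even 4)]
  rw [h]
  exact smul_pauliX_mul_pauliZ_mem_pauliGroup (by simp [mul_pow, hc, hd, hsgn]) _ _

variable [Fintype R] [DecidableEq R]

lemma isClifford_of_intertwines {U : Op R Q} (h₁ : U * Uᴴ = 1) (h₂ : Uᴴ * U = 1)
    (hX : ∀ s : Q → Fin 2, ∃ N ∈ pauliGroup R, U * pauliX s = N * U)
    (hZ : ∀ q : Q, ∃ N ∈ pauliGroup R, U * pauliZ (Pi.single q 1) = N * U) : IsClifford U := by
  have hZ' (r : Q → Fin 2) : ∃ N ∈ pauliGroup R, U * pauliZ r = N * U := by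
    have h0 : ∃ N ∈ pauliGroup R, U * pauliZ (0 : Q → Fin 2) = N * U :=
      ⟨1, by simpa using pauliX_mem_pauliGroup (0 : R → Fin 2), by simp⟩
    induction r using Pi.single_induction with
    | zero => exact h0
    | add r s hr hs =>
      obtain ⟨N, hN, hrN⟩ := hr
      obtain ⟨N', hN', hsN⟩ := hs
      exact ⟨N * N', mul_mem_pauliGroup hN hN', by
        rw [pauliZ_add, ← Matrix.mul_assoc, hrN, Matrix.mul_assoc, hsN, Matrix.mul_assoc]⟩
    | single q a =>
      fin_cases a
      · simpa using h0
      · exact hZ q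
  refine ⟨h₁, h₂, fun M hM => ?_⟩
  obtain ⟨c, s, r, hc, rfl⟩ := exists_eq_smul_pauliX_mul_pauliZ hM
  obtain ⟨N, hN, hsN⟩ := hX s
  obtain ⟨N', hN', hrN⟩ := hZ' r
  have h : U * c • (pauliX s * pauliZ r) * Uᴴ = c • (N * N') := by
    rw [Matrix.mul_smul, ← Matrix.mul_assoc, hsN, Matrix.mul_assoc N, hrN, Matrix.smul_mul,
      Matrix.mul_assoc N, Matrix.mul_assoc N', h₁, Matrix.mul_one]
  rw [h]
  exact smul_mem_pauliGroup hc (mul_mem_pauliGroup hN hN')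

end PauliOperators

/-! ### Disjoint unions of even cycles -/

/-- A disjoint union of cycles of even length with vertices `V`, edges `Q` and components `K`.  The
edges are of two kinds, labelled by `Bool`, which alternate along each cycle: every vertex `v` lies
on one edge `edgeAt i v` of each kind `i`, whose other end is `opp i v`.  One vertex of each
component is marked as its root; `comp` and `vcomp` give the component of an edge and of a
vertex. -/
structure CycleSystem (V Q K : Type*) where
  edgeAt : Bool → V → Q
  opp : Bool → V → V
  root : K → V
  kind : Q → Bool
  comp : Q → K
  vcomp : V → K
  kind_edgeAt : ∀ i v, kind (edgeAt i v) = i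
  comp_edgeAt : ∀ i v, comp (edgeAt i v) = vcomp v
  exists_edgeAt : ∀ q, ∃ i v, edgeAt i v = q
  opp_ne : ∀ i v, opp i v ≠ v
  edgeAt_eq_iff : ∀ i u v, edgeAt i u = edgeAt i v ↔ u = v ∨ u = opp i v
  vcomp_root : ∀ k, vcomp (root k) = k
  reachable : ∀ v, Relation.ReflTransGen (fun u w => ∃ i, w = opp i u) (root (vcomp v)) v

namespace CycleSystem

variable {V Q K : Type*} (S : CycleSystem V Q K)

lemma edgeAt_opp (i : Bool) (v : V) : S.edgeAt i (S.opp i v) = S.edgeAt i v :=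
  (S.edgeAt_eq_iff i _ _).2 (Or.inr rfl)

lemma vcomp_opp (i : Bool) (v : V) : S.vcomp (S.opp i v) = S.vcomp v := by
  rw [← S.comp_edgeAt i, S.edgeAt_opp, S.comp_edgeAt]

lemma edgeAt_inj_kind {i j : Bool} {u v : V} (h : S.edgeAt i u = S.edgeAt j v) : i = j := by
  simpa only [S.kind_edgeAt] using congrArg S.kind h

lemma induction_on_opp {P : V → Prop} (hroot : ∀ k, P (S.root k))
    (hopp : ∀ i v, P v → P (S.opp i v)) (v : V) : P v := by
  have h := S.reachable v
  generalize S.vcomp v = k at h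
  induction h with
  | refl => exact hroot _
  | tail _ hstep ih =>
    obtain ⟨i, rfl⟩ := hstep
    exact hopp i _ ih

/-- The edges of kind `i` in the component `k`. -/
def edges (i : Bool) (k : K) : Set Q := {q | S.kind q = i ∧ S.comp q = k}

lemma edgeAt_mem_edges {i j : Bool} {v : V} {k : K} :
    S.edgeAt j v ∈ S.edges i k ↔ j = i ∧ S.vcomp v = k := by
  rw [edges, Set.mem_ofPred_eq, S.kind_edgeAt, S.comp_edgeAt]

/-- The function on vertices that sums a function on edges over the two edges at a vertex. -/
def vertexSum (r : Q → Fin 2) : V → Fin 2 := fun v => ∑ i, r (S.edgeAt i v)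

section Parity

variable [Fintype Q]

/-- The parity of `x` on the edges of kind `i` of each component. -/
def parity (x : Q → Fin 2) (i : Bool) : K → Fin 2 := fun k => (S.edges i k).indicator 1 ⬝ᵥ x

lemma parity_add (x x' : Q → Fin 2) (i : Bool) :
    S.parity (x + x') i = S.parity x i + S.parity x' i :=
  funext fun _ => dotProduct_add _ _ _

end Parity

/-- The parity of `y` on the vertices of each component. -/
def vparity [Fintype V] (y : V → Fin 2) : K → Fin 2 := fun k => (S.vcomp ⁻¹' {k}).indicator 1 ⬝ᵥ y

/-- The indicator of the edges of kind `i` in the components at whose root `s` is `1`. -/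
def rootSum [Fintype K] (i : Bool) (s : V → Fin 2) : Q → Fin 2 :=
  ∑ k, s (S.root k) • (S.edges i k).indicator 1

lemma rootSum_dotProduct [Fintype Q] [Fintype K] (i : Bool) (s : V → Fin 2) (x : Q → Fin 2) :
    S.rootSum i s ⬝ᵥ x = (s ∘ S.root) ⬝ᵥ S.parity x i := by
  simp only [rootSum, sum_dotProduct, smul_dotProduct, smul_eq_mul]
  rfl

section EdgeVectors

variable [DecidableEq Q]

/-- The edge vector that takes on each edge the sum of `y` over its two ends. -/
def δ [Fintype V] (y : V → Fin 2) : Q → Fin 2 := ∑ v, ∑ i, Pi.single (S.edgeAt i v) (y v)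

/-- The vector supported on the edges at the roots, with the value `p (!i) k` on the edge of kind
`i` at the root of `k`. -/
def corr [Fintype K] (p : Bool → K → Fin 2) : Q → Fin 2 :=
  ∑ k, ∑ i, Pi.single (S.edgeAt i (S.root k)) (p (!i) k)

lemma δ_add [Fintype V] (y y' : V → Fin 2) : S.δ (y + y') = S.δ y + S.δ y' := by
  simp only [δ, Pi.add_apply, Pi.single_add, Finset.sum_add_distrib]

lemma corr_add [Fintype K] (p p' : Bool → K → Fin 2) : S.corr (p + p') = S.corr p + S.corr p' := by
  simp only [corr, Pi.add_apply, Pi.single_add, Finset.sum_add_distrib]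

lemma δ_edgeAt [Fintype V] (y : V → Fin 2) (i : Bool) (v : V) :
    S.δ y (S.edgeAt i v) = y v + y (S.opp i v) := by
  classical
  have h (u : V) (j : Bool) : (Pi.single (S.edgeAt j u) (y u) : Q → Fin 2) (S.edgeAt i v) =
      if j = i then if u = v ∨ u = S.opp i v then y u else 0 else 0 := by
    rw [Pi.single_apply]
    split_ifs with h₁ h₂ h₃ h₂ h₃ <;> grind [S.edgeAt_eq_iff, S.edgeAt_inj_kind]
  have hfilter : ({u | u = v ∨ u = S.opp i v} : Finset V) = {v, S.opp i v} := by ext; simp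
  simp only [δ, Finset.sum_apply, h, Finset.sum_ite_eq', Finset.mem_univ, if_true]
  rw [← Finset.sum_filter, hfilter, Finset.sum_pair (S.opp_ne i v).symm]

lemma corr_apply [Fintype K] (p : Bool → K → Fin 2) (q : Q) :
    S.corr p q =
      if S.edgeAt (S.kind q) (S.root (S.comp q)) = q then p (!S.kind q) (S.comp q) else 0 := by
  have h (k : K) (i : Bool) (hki : k ≠ S.comp q ∨ i ≠ S.kind q) :
      (Pi.single (S.edgeAt i (S.root k)) (p (!i) k) : Q → Fin 2) q = 0 := by
    refine Pi.single_eq_of_ne ?_ _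
    rintro rfl
    simp [S.kind_edgeAt, S.comp_edgeAt, S.vcomp_root] at hki
  simp only [corr, Finset.sum_apply]
  rw [Finset.sum_eq_single (S.comp q) (fun k _ hk => Finset.sum_eq_zero fun i _ => h k i (.inl hk))
    (by simp), Finset.sum_eq_single (S.kind q) (fun i _ hi => h _ i (.inr hi)) (by simp),
    Pi.single_apply]
  simp only [eq_comm]

lemma dotProduct_δ [Fintype V] [Fintype Q] (r : Q → Fin 2) (y : V → Fin 2) :
    r ⬝ᵥ S.δ y = S.vertexSum r ⬝ᵥ y := by
  simp only [δ, dotProduct_sum, dotProduct_single]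
  simp only [dotProduct, vertexSum, Finset.sum_mul]

lemma dotProduct_corr [Fintype Q] [Fintype K] (r : Q → Fin 2) (p : Bool → K → Fin 2) :
    r ⬝ᵥ S.corr p = ∑ k, ∑ i, r (S.edgeAt i (S.root k)) * p (!i) k := by
  simp only [corr, dotProduct_sum, dotProduct_single]

lemma parity_δ [Fintype V] [Fintype Q] (y : V → Fin 2) (i : Bool) :
    S.parity (S.δ y) i = S.vparity y := by
  classical
  funext k
  rw [parity, S.dotProduct_δ, vparity]
  congr 1
  funext v
  simp [vertexSum, Set.indicator_apply, S.edgeAt_mem_edges, ite_and, -Finset.sum_boole,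
    -Fintype.univ_bool]

lemma parity_corr [Fintype Q] [Fintype K] (p : Bool → K → Fin 2) (i : Bool) :
    S.parity (S.corr p) i = p (!i) := by
  classical
  funext k
  rw [parity, S.dotProduct_corr]
  cases i <;> simp [Set.indicator_apply, S.edgeAt_mem_edges, S.vcomp_root]

lemma eq_of_δ_eq [Fintype V] {y y' : V → Fin 2} (h : S.δ y = S.δ y')
    (hroot : ∀ k, y (S.root k) = y' (S.root k)) : y = y' := by
  refine funext (S.induction_on_opp hroot fun i v hv => ?_)
  have hi := congrFun h (S.edgeAt i v)
  rwa [S.δ_edgeAt, S.δ_edgeAt, hv, add_right_inj] at hi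

lemma single_opp [DecidableEq V] (i : Bool) (v : V) :
    (Pi.single (S.opp i v) 1 : V → Fin 2) =
      S.vertexSum (Pi.single (S.edgeAt i v) 1) + Pi.single v 1 := by
  have h (j : Bool) (u : V) : (Pi.single (S.edgeAt i v) 1 : Q → Fin 2) (S.edgeAt j u) =
      if j = i then if u = v ∨ u = S.opp i v then 1 else 0 else 0 := by
    rw [Pi.single_apply]
    split_ifs <;> grind [S.edgeAt_eq_iff, S.edgeAt_inj_kind]
  funext u
  rw [Pi.add_apply, vertexSum, Finset.sum_congr rfl fun j _ => h j u, Finset.sum_ite_eq',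
    if_pos (Finset.mem_univ i), Pi.single_apply, Pi.single_apply]
  have := S.opp_ne i v
  split_ifs <;> grind

end EdgeVectors

lemma card_eq (S : CycleSystem V Q K) [Fintype V] [Fintype Q] :
    Fintype.card V = Fintype.card Q := by
  classical
  have hfiber (q : Q) : Fintype.card {p : Bool × V // S.edgeAt p.1 p.2 = q} = 2 := by
    obtain ⟨i, v, rfl⟩ := S.exists_edgeAt q
    rw [Fintype.card_subtype, ← Finset.card_pair
      (fun h => S.opp_ne i v (congrArg Prod.snd h).symm : (i, v) ≠ (i, S.opp i v))]
    congr 1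
    ext ⟨j, u⟩
    simp only [Finset.mem_filter_univ, Finset.mem_insert, Finset.mem_singleton, Prod.mk.injEq]
    grind [S.edgeAt_eq_iff, S.edgeAt_inj_kind]
  have h := Fintype.card_congr (Equiv.sigmaFiberEquiv fun p : Bool × V => S.edgeAt p.1 p.2)
  simp only [Fintype.card_sigma, hfiber, Finset.sum_const, Finset.card_univ, smul_eq_mul,
    Fintype.card_prod, Fintype.card_bool] at h
  omega

end CycleSystem

/-! ### Hadamard transforms -/

/-- The Hadamard matrix, with entries `(-1) ^ (a * b) / √2`. -/
def σH : Matrix (Fin 2) (Fin 2) ℂ := Matrix.of fun a b => (√2 : ℂ)⁻¹ * sgn (a * b)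

lemma conjTranspose_σH_mul_self : σHᴴ * σH = 1 := by
  have h : ((√2 : ℝ) : ℂ)⁻¹ * ((√2 : ℝ) : ℂ)⁻¹ = 2⁻¹ := by
    rw [← mul_inv, ← Complex.ofReal_mul, Real.mul_self_sqrt zero_le_two, Complex.ofReal_ofNat]
  ext a b
  fin_cases a <;> fin_cases b <;> norm_num [σH, Matrix.mul_apply, h]

section Hadamard

variable {K : Type*} [Fintype K]

/-- The Hadamard transform `σH` on each of the qubits `K`. -/
def hadamard : Op K K := tensorPow fun _ => σH

lemma hadamard_apply (b s : K → Fin 2) : hadamard b s = ∏ k, (√2 : ℂ)⁻¹ * sgn (b k * s k) := rfl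

lemma hadamard_add_left (b b' s : K → Fin 2) :
    hadamard (b + b') s = sgn (b' ⬝ᵥ s) * hadamard b s := by
  simp only [hadamard_apply, dotProduct, sgn_sum, ← Finset.prod_mul_distrib, Pi.add_apply, add_mul,
    AddChar.map_add_eq_mul]
  exact Finset.prod_congr rfl fun k _ => by ring

lemma hadamard_add_right (b s s' : K → Fin 2) :
    hadamard b (s + s') = sgn (b ⬝ᵥ s') * hadamard b s := by
  simpa only [hadamard_apply, mul_comm, dotProduct_comm] using hadamard_add_left s s' b

lemma conjTranspose_hadamard_mul_self [DecidableEq K] : (hadamard : Op K K)ᴴ * hadamard = 1 := by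
  have h : (hadamard : Op K K)ᴴ = tensorPow fun _ => σHᴴ := by
    ext b s
    simp [hadamard, tensorPow, Matrix.conjTranspose_apply]
  rw [h, hadamard, tensorPow_mul, conjTranspose_σH_mul_self, tensorPow_one]

end Hadamard

namespace CycleSystem

variable {V Q K : Type*} [Fintype V] [Fintype Q] [DecidableEq Q] [Fintype K]
  (S : CycleSystem V Q K)

/-! ### The unitary of a disjoint union of cycles -/

/-- The pairs of basis vectors between which `S.unitary` has a non-zero entry.  Without the
correction, `x = S.δ y` would have the same parity on the edges of both kinds. -/
def Compat (x : Q → Fin 2) (y : V → Fin 2) : Prop := S.δ y = x + S.corr (S.parity x)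

lemma compat_add {x x' : Q → Fin 2} {y y' : V → Fin 2} (h : S.Compat x y) (h' : S.Compat x' y') :
    S.Compat (x + x') (y + y') := by
  have hp : S.parity (x + x') = S.parity x + S.parity x' := funext fun i => S.parity_add x x' i
  rw [Compat] at *
  rw [S.δ_add, hp, S.corr_add, h, h', add_add_add_comm]

lemma compat_add_iff {x x' : Q → Fin 2} {y y' : V → Fin 2} (h' : S.Compat x' y') :
    S.Compat (x + x') (y + y') ↔ S.Compat x y := by
  refine ⟨fun h => ?_, fun h => S.compat_add h h'⟩
  simpa only [bits_add_add_cancel] using S.compat_add h h'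

/-- The edge vector compatible with `y` whose parities on the edges of kind `true` are `b`. -/
def lift (y : V → Fin 2) (b : K → Fin 2) : Q → Fin 2 :=
  S.δ y + S.corr fun i => cond i b (b + S.vparity y)

lemma parity_lift (y : V → Fin 2) (b : K → Fin 2) :
    S.parity (S.lift y b) = fun i => cond i b (b + S.vparity y) := by
  funext i
  rw [lift, S.parity_add, S.parity_δ, S.parity_corr, add_comm]
  cases i
  · rfl
  · exact bits_add_add_cancel _ _

lemma parity_lift_true (y : V → Fin 2) (b : K → Fin 2) : S.parity (S.lift y b) true = b := by
  rw [S.parity_lift]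
  exact cond_true _ _

lemma compat_lift (y : V → Fin 2) (b : K → Fin 2) : S.Compat (S.lift y b) y := by
  rw [Compat, S.parity_lift, lift, bits_add_add_cancel]

lemma eq_lift_of_compat {x : Q → Fin 2} {y : V → Fin 2} (h : S.Compat x y) :
    x = S.lift y (S.parity x true) := by
  have hx : x = S.δ y + S.corr (S.parity x) := bits_eq_add_iff.2 h
  have hfalse : S.parity x false = S.parity x true + S.vparity y := by
    conv_lhs => rw [hx, S.parity_add, S.parity_δ, S.parity_corr, add_comm]
    rfl
  conv_lhs => rw [hx]
  rw [lift]
  congr 2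
  funext i
  cases i
  · exact hfalse
  · rfl

lemma sum_eq_sum_lift [DecidableEq K] {y : V → Fin 2} {f : (Q → Fin 2) → ℂ}
    (hf : ∀ x, ¬ S.Compat x y → f x = 0) :
    ∑ x, f x = ∑ b, f (S.lift y b) := by
  classical
  refine (Finset.sum_of_injOn (S.lift y) (fun b _ b' _ h => ?_) (by simp) (fun x _ hx => ?_)
    fun _ _ => rfl).symm
  · rw [← S.parity_lift_true y b, h, S.parity_lift_true]
  · exact hf x fun h => hx ⟨S.parity x true, by simp, (S.eq_lift_of_compat h).symm⟩

open scoped Classical in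
/-- The unitary operator attached to a system of cycles: it maps a basis vector `y` to a combination
of the basis vectors compatible with it, with the signs of the Hadamard transform from the values
of `y` at the roots to the parities on the edges of kind `true`. -/
def unitary : Op Q V :=
  Matrix.of fun x y => if S.Compat x y then hadamard (S.parity x true) (y ∘ S.root) else 0

lemma unitary_of_compat {x : Q → Fin 2} {y : V → Fin 2} (h : S.Compat x y) :
    S.unitary x y = hadamard (S.parity x true) (y ∘ S.root) :=
  if_pos h

lemma unitary_of_not_compat {x : Q → Fin 2} {y : V → Fin 2} (h : ¬ S.Compat x y) :
    S.unitary x y = 0 :=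
  if_neg h

lemma conjTranspose_mul_unitary_apply_of_δ_ne {y y' : V → Fin 2} (h : S.δ y ≠ S.δ y') :
    (S.unitaryᴴ * S.unitary) y y' = 0 := by
  rw [Matrix.mul_apply]
  refine Finset.sum_eq_zero fun x _ => ?_
  by_cases hx : S.Compat x y
  · rw [S.unitary_of_not_compat (y := y') fun hx' => h (hx.trans hx'.symm), mul_zero]
  · rw [conjTranspose_apply, S.unitary_of_not_compat hx, star_zero, zero_mul]

lemma conjTranspose_mul_unitary_apply_of_δ_eq [DecidableEq K] {y y' : V → Fin 2}
    (h : S.δ y = S.δ y') :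
    (S.unitaryᴴ * S.unitary) y y' =
      (hadamardᴴ * hadamard : Op K K) (y ∘ S.root) (y' ∘ S.root) := by
  rw [Matrix.mul_apply, Matrix.mul_apply, S.sum_eq_sum_lift (y := y)]
  · refine Finset.sum_congr rfl fun b _ => ?_
    have hb : S.Compat (S.lift y b) y' := h.symm.trans (S.compat_lift y b)
    rw [conjTranspose_apply, conjTranspose_apply, S.unitary_of_compat (S.compat_lift y b),
      S.unitary_of_compat hb, S.parity_lift_true]
  · intro x hx
    rw [conjTranspose_apply, S.unitary_of_not_compat hx, star_zero, zero_mul]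

lemma conjTranspose_mul_unitary : S.unitaryᴴ * S.unitary = 1 := by
  classical
  ext y y'
  by_cases h : S.δ y = S.δ y'
  · rw [S.conjTranspose_mul_unitary_apply_of_δ_eq h, conjTranspose_hadamard_mul_self, one_apply,
      one_apply]
    congr 1
    exact propext ⟨fun hr => S.eq_of_δ_eq h (congrFun hr), fun hy => by rw [hy]⟩
  · rw [S.conjTranspose_mul_unitary_apply_of_δ_ne h, one_apply_ne (ne_of_apply_ne S.δ h)]

lemma unitary_mul_conjTranspose [DecidableEq V] : S.unitary * S.unitaryᴴ = 1 :=
  (Matrix.mul_eq_one_comm_of_card_eq (V → Fin 2) (Q → Fin 2) ℂ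
    (by simp [S.card_eq])).1 S.conjTranspose_mul_unitary

/-! ### Images of the Pauli operators -/

variable [DecidableEq V]

lemma unitary_mul_pauliX_of_compat {t : Q → Fin 2} {s : V → Fin 2} (h : S.Compat t s) :
    S.unitary * pauliX s = pauliZ (S.rootSum true s) * pauliX t * S.unitary *
      pauliZ (∑ k, Pi.single (S.root k) (S.parity t true k)) := by
  ext x y
  have hroot : (∑ k, Pi.single (S.root k) (S.parity t true k)) ⬝ᵥ y =
      S.parity t true ⬝ᵥ (y ∘ S.root) := by
    simp only [sum_dotProduct, single_dotProduct]
    rfl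
  have hcompat : S.Compat (x + t) y ↔ S.Compat x (y + s) := by
    rw [← S.compat_add_iff h, bits_add_add_cancel]
  rw [mul_pauliX_apply, mul_pauliZ_apply, Matrix.mul_assoc, pauliZ_mul_apply, pauliX_mul_apply,
    hroot, S.rootSum_dotProduct]
  by_cases hx : S.Compat x (y + s)
  · have hsgn : sgn (S.parity t true ⬝ᵥ (y ∘ S.root)) * sgn (S.parity t true ⬝ᵥ (y ∘ S.root)) =
        1 := by
      rw [← AddChar.map_add_eq_mul, CharTwo.add_self_eq_zero, AddChar.map_zero_eq_one]
    rw [S.unitary_of_compat hx, S.unitary_of_compat (hcompat.2 hx), Pi.add_comp,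
      hadamard_add_right, S.parity_add, hadamard_add_left, dotProduct_comm (s ∘ S.root)]
    linear_combination -sgn (S.parity x true ⬝ᵥ (s ∘ S.root)) *
      hadamard (S.parity x true) (y ∘ S.root) * hsgn
  · rw [S.unitary_of_not_compat hx, S.unitary_of_not_compat (mt hcompat.1 hx), mul_zero, zero_mul]

lemma unitary_mul_pauliX_of_parity_eq_zero {t : Q → Fin 2} {s : V → Fin 2} (h : S.Compat t s)
    (ht : S.parity t true = 0) :
    S.unitary * pauliX s = pauliZ (S.rootSum true s) * pauliX t * S.unitary := by
  rw [S.unitary_mul_pauliX_of_compat h, ht]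
  simp

lemma unitary_mul_pauliZ_root (k : K) :
    ∃ t : Q → Fin 2, S.unitary * pauliZ (Pi.single (S.root k) 1) = pauliX t * S.unitary := by
  classical
  have hb : S.parity (S.lift 0 (Pi.single k 1)) true = Pi.single k 1 := S.parity_lift_true _ _
  have hsum : (∑ l, Pi.single (S.root l) ((Pi.single k 1 : K → Fin 2) l)) =
      (Pi.single (S.root k) 1 : V → Fin 2) := by
    rw [Finset.sum_eq_single k] <;> simp +contextual
  have h := S.unitary_mul_pauliX_of_compat (S.compat_lift 0 (Pi.single k 1))
  rw [hb, hsum] at h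
  refine ⟨S.lift 0 (Pi.single k 1), ?_⟩
  rw [pauliX_zero, Matrix.mul_one] at h
  conv_lhs => rw [h, Matrix.mul_assoc, pauliZ_mul_self, Matrix.mul_one]
  simp [rootSum]

lemma unitary_mul_pauliZ_vertexSum (r : Q → Fin 2) :
    S.unitary * pauliZ (S.vertexSum r) =
      pauliZ (r + ∑ i, S.rootSum (!i) (r ∘ S.edgeAt i)) * S.unitary := by
  ext x y
  rw [mul_pauliZ_apply, pauliZ_mul_apply]
  by_cases h : S.Compat x y
  · have hr : S.vertexSum r ⬝ᵥ y = (r + ∑ i, S.rootSum (!i) (r ∘ S.edgeAt i)) ⬝ᵥ x := by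
      rw [← S.dotProduct_δ, h, dotProduct_add, S.dotProduct_corr, Finset.sum_comm, add_dotProduct,
        sum_dotProduct]
      simp only [S.rootSum_dotProduct]
      rfl
    rw [hr, mul_comm]
  · rw [S.unitary_of_not_compat h, zero_mul, mul_zero]

lemma isClifford_unitary : IsClifford S.unitary := by
  refine isClifford_of_intertwines S.unitary_mul_conjTranspose S.conjTranspose_mul_unitary
    (fun s => ?_) (S.induction_on_opp (fun k => ?_) fun i v hv => ?_)
  · exact ⟨_, mul_mem_pauliGroup (pauliZ_mem_pauliGroup _) (pauliX_mem_pauliGroup _),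
      S.unitary_mul_pauliX_of_parity_eq_zero (S.compat_lift s 0) (S.parity_lift_true s 0)⟩
  · obtain ⟨t, ht⟩ := S.unitary_mul_pauliZ_root k
    exact ⟨_, pauliX_mem_pauliGroup t, ht⟩
  · obtain ⟨N, hN, hv⟩ := hv
    obtain ⟨r, hr⟩ : ∃ r : Q → Fin 2,
        S.unitary * pauliZ (S.vertexSum (Pi.single (S.edgeAt i v) 1)) = pauliZ r * S.unitary :=
      ⟨_, S.unitary_mul_pauliZ_vertexSum _⟩
    refine ⟨_, mul_mem_pauliGroup (pauliZ_mem_pauliGroup r) hN, ?_⟩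
    rw [S.single_opp, pauliZ_add, ← Matrix.mul_assoc, hr, Matrix.mul_assoc, hv, Matrix.mul_assoc]

end CycleSystem

namespace CycleSystem

variable {V Q K : Type*} (S : CycleSystem V Q K)

/-! ### Restriction to one component -/

section Restrict

variable (k : K) {pV : V → Prop} {pQ : Q → Prop}
  (hV : ∀ v, pV v ↔ S.vcomp v = k) (hQ : ∀ q, pQ q ↔ S.comp q = k)

/-- One component of a system of cycles, on the vertices and edges singled out by `pV` and `pQ`. -/
def restrict : CycleSystem {v // pV v} {q // pQ q} Unit where
  edgeAt i v := ⟨S.edgeAt i v, (hQ _).2 ((S.comp_edgeAt i v).trans ((hV v).1 v.2))⟩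
  opp i v := ⟨S.opp i v, (hV _).2 ((S.vcomp_opp i v).trans ((hV v).1 v.2))⟩
  root _ := ⟨S.root k, (hV _).2 (S.vcomp_root k)⟩
  kind q := S.kind q
  comp _ := ()
  vcomp _ := ()
  kind_edgeAt i v := S.kind_edgeAt i v
  comp_edgeAt _ _ := rfl
  exists_edgeAt := by
    rintro ⟨q, hq⟩
    obtain ⟨i, v, rfl⟩ := S.exists_edgeAt q
    exact ⟨i, ⟨v, (hV v).2 ((S.comp_edgeAt i v).symm.trans ((hQ _).1 hq))⟩, rfl⟩
  opp_ne i v h := S.opp_ne i v (congrArg Subtype.val h)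
  edgeAt_eq_iff i u v := by simpa only [Subtype.ext_iff] using S.edgeAt_eq_iff i u v
  vcomp_root _ := rfl
  reachable := by
    rintro ⟨v, hv⟩
    induction v using S.induction_on_opp with
    | hroot l =>
      obtain rfl : l = k := (S.vcomp_root l).symm.trans ((hV _).1 hv)
      exact Relation.ReflTransGen.refl
    | hopp i v ih =>
      have hv' : pV v := (hV v).2 ((S.vcomp_opp i v).symm.trans ((hV _).1 hv))
      exact (ih hv').tail ⟨i, rfl⟩

lemma parity_restrict [Fintype Q] [Fintype {q // pQ q}] (x : Q → Fin 2) (i : Bool) :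
    (S.restrict k hV hQ).parity (fun q => x q) i = fun _ => S.parity x i k := by
  classical
  funext _
  refine Fintype.sum_of_injective Subtype.val Subtype.val_injective _ _ (fun q hq => ?_) fun q => ?_
  · rw [Set.indicator_of_notMem fun h => hq ⟨⟨q, (hQ q).2 h.2⟩, rfl⟩, zero_mul]
  · congr 1
    simp [Set.indicator_apply, edges, restrict, (hQ q).1 q.2]

variable [DecidableEq Q]

lemma δ_restrict [Fintype V] [Fintype {v // pV v}] (y : V → Fin 2) (q : {q // pQ q}) :
    (S.restrict k hV hQ).δ (fun v => y v) q = S.δ y q := by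
  obtain ⟨i, v, rfl⟩ := (S.restrict k hV hQ).exists_edgeAt q
  rw [δ_edgeAt]
  exact (S.δ_edgeAt y i v).symm

lemma corr_restrict [Fintype K] (p : Bool → K → Fin 2) (q : {q // pQ q}) :
    (S.restrict k hV hQ).corr (fun i _ => p i k) q = S.corr p q := by
  rw [corr_apply, corr_apply, (hQ q).1 q.2]
  exact if_congr Subtype.ext_iff rfl rfl

lemma compat_restrict [Fintype V] [Fintype Q] [Fintype K] [Fintype {v // pV v}]
    [Fintype {q // pQ q}] (x : Q → Fin 2) (y : V → Fin 2) :
    (S.restrict k hV hQ).Compat (fun q => x q) (fun v => y v) ↔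
      ∀ q, pQ q → S.δ y q = x q + S.corr (S.parity x) q := by
  have hp : (S.restrict k hV hQ).parity (fun q => x q) = fun i _ => S.parity x i k :=
    funext (S.parity_restrict k hV hQ x)
  simp only [Compat, hp, funext_iff, Subtype.forall, Pi.add_apply, δ_restrict, corr_restrict]

end Restrict

variable [Fintype V] [Fintype Q] [DecidableEq Q] [Fintype K]

lemma unitary_eq_prod {pV : K → V → Prop} {pQ : K → Q → Prop}
    (hV : ∀ k v, pV k v ↔ S.vcomp v = k) (hQ : ∀ k q, pQ k q ↔ S.comp q = k)
    [∀ k, Fintype {v // pV k v}] [∀ k, Fintype {q // pQ k q}] (x : Q → Fin 2) (y : V → Fin 2) :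
    S.unitary x y =
      ∏ k, (S.restrict k (hV k) (hQ k)).unitary (fun q => x q) (fun v => y v) := by
  by_cases h : S.Compat x y
  · rw [S.unitary_of_compat h, hadamard_apply]
    refine Finset.prod_congr rfl fun k _ => ?_
    rw [unitary_of_compat _ ((S.compat_restrict k (hV k) (hQ k) x y).2 fun q _ => congrFun h q),
      parity_restrict, hadamard_apply, Fintype.prod_unique]
    rfl
  · obtain ⟨q, hq⟩ := Function.ne_iff.1 h
    rw [S.unitary_of_not_compat h, eq_comm]
    refine Finset.prod_eq_zero (Finset.mem_univ (S.comp q)) (unitary_of_not_compat _ fun h' => ?_)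
    exact hq ((S.compat_restrict _ _ _ x y).1 h' q ((hQ _ q).2 rfl))

end CycleSystem

/-! ### Conjugation and tensor products as homomorphisms -/

section Homs

variable {Q R : Type*} [Fintype Q] [Fintype R]

lemma tensor_one : tensor (1 : Op Q Q) (1 : Op R R) = 1 := by
  ext x y
  simp only [tensor, Matrix.of_apply, Matrix.one_apply]
  rw [ite_zero_mul_ite_zero, mul_one]
  exact if_congr (by simp only [funext_iff, Sum.forall]) rfl rfl

variable [DecidableEq Q] [DecidableEq R]

/-- Conjugation by a unitary, as a homomorphism of groups of invertible operators. -/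
def conjHom (U : Op R Q) (h₁ : U * Uᴴ = 1) (h₂ : Uᴴ * U = 1) : (Op Q Q)ˣ →* (Op R R)ˣ :=
  Units.map
    { toFun := fun M => U * M * Uᴴ
      map_one' := by rw [Matrix.mul_one, h₁]
      map_mul' := fun M N => by
        rw [Matrix.mul_assoc (U * M), Matrix.mul_assoc U N, ← Matrix.mul_assoc Uᴴ, h₂,
          Matrix.one_mul]
        simp only [Matrix.mul_assoc] }

lemma conjHom_eq {U : Op R Q} {h₁ : U * Uᴴ = 1} {h₂ : Uᴴ * U = 1} {g : (Op Q Q)ˣ}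
    {g' : (Op R R)ˣ} (h : U * (g : Op Q Q) = (g' : Op R R) * U) : conjHom U h₁ h₂ g = g' :=
  Units.ext <| show U * (g : Op Q Q) * Uᴴ = g' by rw [h, Matrix.mul_assoc, h₁, Matrix.mul_one]

lemma conj_ops_eq (U : Op R Q) (h₁ : U * Uᴴ = 1) (h₂ : Uᴴ * U = 1) (G : Subgroup (Op Q Q)ˣ) :
    {T | ∃ M ∈ ops G, T = U * M * Uᴴ} = ops (G.map (conjHom U h₁ h₂)) := by
  ext T
  constructor
  · rintro ⟨_, ⟨g, hg, rfl⟩, rfl⟩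
    exact ⟨_, ⟨g, hg, rfl⟩, rfl⟩
  · rintro ⟨_, ⟨g, hg, rfl⟩, rfl⟩
    exact ⟨_, ⟨g, hg, rfl⟩, rfl⟩

lemma tensor_mul (M M' : Op Q Q) (N N' : Op R R) :
    tensor (M * M') (N * N') = tensor M N * tensor M' N' := by
  ext x y
  simp only [tensor, Matrix.of_apply, Matrix.mul_apply]
  rw [Finset.sum_mul_sum, ← Fintype.sum_prod_type']
  refine (Fintype.sum_equiv (Equiv.sumArrowEquivProdArrow Q R (Fin 2)) _ _ fun z => ?_).symm
  simp only [Equiv.sumArrowEquivProdArrow, Equiv.coe_fn_mk, Function.comp_def]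
  ring

/-- The tensor product, as a homomorphism of groups of invertible operators. -/
def tensorHom : (Op Q Q)ˣ × (Op R R)ˣ →* (Op (Q ⊕ R) (Q ⊕ R))ˣ :=
  (Units.map
    { toFun := fun p : Op Q Q × Op R R => tensor p.1 p.2
      map_one' := tensor_one
      map_mul' := fun _ _ => tensor_mul _ _ _ _ }).comp MulEquiv.prodUnits.symm.toMonoidHom

lemma tensorGroup_eq (G : Subgroup (Op Q Q)ˣ) (H : Subgroup (Op R R)ˣ) :
    tensorGroup G H = ops ((G.prod H).map tensorHom) := by
  ext T
  constructor
  · rintro ⟨_, ⟨g, hg, rfl⟩, _, ⟨h, hh, rfl⟩, rfl⟩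
    exact ⟨tensorHom (g, h), ⟨(g, h), ⟨hg, hh⟩, rfl⟩, rfl⟩
  · rintro ⟨_, ⟨⟨g, h⟩, ⟨hg, hh⟩, rfl⟩, rfl⟩
    exact ⟨_, ⟨g, hg, rfl⟩, _, ⟨h, hh, rfl⟩, rfl⟩

end Homs

/-! ### Flags of a colored 3-valent lattice -/

namespace Lattice

variable {V E F Φ : Type*} {L : Lattice V E F Φ} {col : F → Color}

lemma flags_of_vert (h3 : L.ThreeValent) {φ ψ : Φ} (h : L.vert ψ = L.vert φ) :
    ψ = φ ∨ ψ = L.τ1 φ ∨ ψ = L.τ2 φ ∨ ψ = L.τ1 (L.τ2 φ) ∨ ψ = L.τ2 (L.τ1 φ) ∨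
      ψ = L.τ1 (L.τ2 (L.τ1 φ)) := by
  have hψ : SameOrbit L.τ1 L.τ2 φ ψ := (L.vert_eq_iff φ ψ).1 h.symm
  clear h
  induction hψ with
  | refl => exact Or.inl rfl
  | tail _ hstep ih => grind [L.τ1_τ1, L.τ2_τ2, braid h3]

lemma flags_of_edge {φ ψ : Φ} (h : L.edge ψ = L.edge φ) :
    ψ = φ ∨ ψ = L.τ0 φ ∨ ψ = L.τ2 φ ∨ ψ = L.τ0 (L.τ2 φ) := by
  have hψ : SameOrbit L.τ0 L.τ2 φ ψ := (L.edge_eq_iff φ ψ).1 h.symm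
  clear h
  induction hψ with
  | refl => exact Or.inl rfl
  | tail _ hstep ih => grind [L.τ0_τ0, L.τ2_τ2, L.τ0_τ2]

lemma mem_coboundary_iff (L : Lattice V E F Φ) (φ : Φ) (v : V) :
    L.edge φ ∈ L.coboundary v ↔ ¬ (L.vert φ = v ↔ L.vert (L.τ0 φ) = v) := by
  constructor
  · rintro ⟨ψ, he, h1, h2⟩
    rcases flags_of_edge he with rfl | rfl | rfl | rfl <;>
      grind [L.τ0_τ2, L.τ0_τ0, L.vert_τ2]
  · intro h
    by_cases h1 : L.vert φ = v
    · exact ⟨φ, rfl, h1, by tauto⟩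
    · exact ⟨L.τ0 φ, L.edge_τ0 φ, by tauto, by rwa [L.τ0_τ0]⟩

lemma mem_boundary_iff (L : Lattice V E F Φ) (φ : Φ) (f : F) :
    L.edge φ ∈ L.boundary f ↔ ¬ (L.face φ = f ↔ L.face (L.τ2 φ) = f) := by
  constructor
  · rintro ⟨ψ, he, h1, h2⟩
    have hcomm := L.τ0_τ2 φ
    rcases flags_of_edge he with rfl | rfl | rfl | rfl <;> grind [L.τ2_τ2, L.face_τ0]
  · intro h
    by_cases h1 : L.face φ = f
    · exact ⟨φ, rfl, h1, by tauto⟩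
    · exact ⟨L.τ2 φ, L.edge_τ2 φ, by tauto, by rwa [L.τ2_τ2]⟩

lemma flags_of_vert_of_col (h3 : L.ThreeValent) (hc : L.ProperColoring col) {φ ψ : Φ}
    (h : L.vert ψ = L.vert φ) (hcol : col (L.face ψ) = col (L.face φ)) : ψ = φ ∨ ψ = L.τ1 φ := by
  have h2 := hc φ
  have h1 := hc (L.τ1 φ)
  rcases flags_of_vert h3 h with rfl | rfl | rfl | rfl | rfl | rfl <;> grind [L.face_τ1]

lemma flags_of_edge_of_col (hc : L.ProperColoring col) {φ ψ : Φ}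
    (h : L.edge ψ = L.edge φ) (hcol : col (L.face ψ) = col (L.face φ)) : ψ = φ ∨ ψ = L.τ0 φ := by
  have h2 := hc φ
  rcases flags_of_edge h with rfl | rfl | rfl | rfl <;> grind [L.face_τ0]

lemma face_eq_of_vert_of_col (h3 : L.ThreeValent) (hc : L.ProperColoring col) {φ ψ : Φ}
    (h : L.vert ψ = L.vert φ) (hcol : col (L.face ψ) = col (L.face φ)) : L.face ψ = L.face φ := by
  rcases flags_of_vert_of_col h3 hc h hcol with rfl | rfl
  · rfl
  · rw [L.face_τ1]

lemma face_eq_of_edge_of_col (hc : L.ProperColoring col) {φ ψ : Φ}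
    (h : L.edge ψ = L.edge φ) (hcol : col (L.face ψ) = col (L.face φ)) : L.face ψ = L.face φ := by
  rcases flags_of_edge_of_col hc h hcol with rfl | rfl
  · rfl
  · rw [L.face_τ0]

lemma mem_faceVerts_iff (h3 : L.ThreeValent) (hc : L.ProperColoring col) {φ : Φ} {f : F}
    (hcol : col (L.face φ) = col f) : L.vert φ ∈ L.faceVerts f ↔ L.face φ = f := by
  refine ⟨?_, fun h => ⟨φ, rfl, h⟩⟩
  rintro ⟨ψ, hv, rfl⟩
  exact (face_eq_of_vert_of_col h3 hc hv hcol.symm).symm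

lemma mem_faceEdges_iff (hc : L.ProperColoring col) {φ : Φ} {f : F}
    (hcol : col (L.face φ) = col f) : L.edge φ ∈ L.faceEdges f ↔ L.face φ = f := by
  refine ⟨?_, fun h => ⟨φ, rfl, h⟩⟩
  rintro ⟨ψ, he, rfl⟩
  exact (face_eq_of_edge_of_col hc he hcol.symm).symm

lemma color_eq_of_ne {c d x y : Color} (hcd : d ≠ c) (hxc : x ≠ c) (hxd : x ≠ d) (hyc : y ≠ c)
    (hyd : y ≠ d) : x = y := by
  cases c <;> cases d <;> cases x <;> cases y <;> simp_all

lemma exists_vert_eq_of_col (h3 : L.ThreeValent) (hc : L.ProperColoring col) (c : Color) (v : V) :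
    ∃ φ, L.vert φ = v ∧ col (L.face φ) = c := by
  obtain ⟨φ, rfl⟩ := L.vert_surj v
  by_cases h : L.Avoids col c (L.edge φ)
  · exact ⟨L.τ2 (L.τ1 φ), by rw [L.vert_τ2, L.vert_τ1], (avoids_iff_third h3 hc c φ).1 h⟩
  · rw [avoids_iff, not_and_or, not_not, not_not] at h
    rcases h with h | h
    exacts [⟨φ, rfl, h⟩, ⟨L.τ2 φ, L.vert_τ2 φ, h⟩]

section Flag

variable {c d : Color}

lemma exists_edge_eq_of_col (hc : L.ProperColoring col) (hd : d ≠ c) {e : E}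
    (he : L.Avoids col d e) : ∃ φ, L.edge φ = e ∧ col (L.face φ) = c := by
  obtain ⟨φ, rfl⟩ := L.edge_surj e
  obtain ⟨h1, h2⟩ := (avoids_iff d φ).1 he
  by_contra! h
  exact hc φ (color_eq_of_ne hd (h φ rfl) h1 (h _ (L.edge_τ2 φ)) h2)

lemma avoids_or_avoids {d' : Color} (hd : d ≠ c) (hd' : d' ≠ c) (hdd' : d ≠ d') {φ : Φ}
    (hφ : col (L.face φ) = c) :
    L.Avoids col d (L.edge φ) ∨ L.Avoids col d' (L.edge φ) := by
  rw [avoids_iff, avoids_iff]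
  grind

lemma exists_flag (h3 : L.ThreeValent) (hc : L.ProperColoring col) (hd : d ≠ c) (v : V) :
    ∃ φ, L.vert φ = v ∧ col (L.face φ) = c ∧ L.Avoids col d (L.edge φ) := by
  obtain ⟨φ, rfl, hφ⟩ := exists_vert_eq_of_col h3 hc c v
  by_cases h : L.Avoids col d (L.edge φ)
  · exact ⟨φ, rfl, hφ, h⟩
  · exact ⟨L.τ1 φ, L.vert_τ1 φ, by rw [L.face_τ1, hφ],
      (avoids_τ1_iff h3 hc d φ (hφ.trans_ne hd.symm)).2 h⟩

/-- The face of color `c` at a vertex. -/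
def faceOfVert (h3 : L.ThreeValent) (hc : L.ProperColoring col) (c : Color) (v : V) :
    {f : F // col f = c} :=
  ⟨L.face (exists_vert_eq_of_col h3 hc c v).choose,
    (exists_vert_eq_of_col h3 hc c v).choose_spec.2⟩

lemma faceOfVert_vert (h3 : L.ThreeValent) (hc : L.ProperColoring col) {φ : Φ}
    (hφ : col (L.face φ) = c) : faceOfVert h3 hc c (L.vert φ) = ⟨L.face φ, hφ⟩ := by
  obtain ⟨hv, hcol⟩ := (exists_vert_eq_of_col h3 hc c (L.vert φ)).choose_spec
  exact Subtype.ext (face_eq_of_vert_of_col h3 hc hv (hcol.trans hφ.symm))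

lemma mem_faceVerts_iff_faceOfVert (h3 : L.ThreeValent) (hc : L.ProperColoring col) {f : F}
    (hf : col f = c) (v : V) : v ∈ L.faceVerts f ↔ faceOfVert h3 hc c v = ⟨f, hf⟩ := by
  obtain ⟨φ, rfl, hφ⟩ := exists_vert_eq_of_col h3 hc c v
  rw [mem_faceVerts_iff h3 hc (hφ.trans hf.symm), faceOfVert_vert h3 hc hφ, Subtype.mk.injEq]

/-- The face of color `c` along an edge avoiding another color `d`. -/
def faceOfEdge (hc : L.ProperColoring col) (hd : d ≠ c) (e : {e : E // L.Avoids col d e}) :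
    {f : F // col f = c} :=
  ⟨L.face (exists_edge_eq_of_col hc hd e.2).choose,
    (exists_edge_eq_of_col hc hd e.2).choose_spec.2⟩

lemma faceOfEdge_edge (hc : L.ProperColoring col) (hd : d ≠ c) {φ : Φ}
    (hφ : col (L.face φ) = c) (ha : L.Avoids col d (L.edge φ)) :
    faceOfEdge hc hd ⟨L.edge φ, ha⟩ = ⟨L.face φ, hφ⟩ := by
  obtain ⟨he, hcol⟩ := (exists_edge_eq_of_col hc hd ha).choose_spec
  exact Subtype.ext (face_eq_of_edge_of_col hc he (hcol.trans hφ.symm))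

lemma mem_faceEdges_iff_faceOfEdge (hc : L.ProperColoring col) (hd : d ≠ c) {f : F}
    (hf : col f = c) (e : {e : E // L.Avoids col d e}) :
    e.1 ∈ L.faceEdges f ↔ faceOfEdge hc hd e = ⟨f, hf⟩ := by
  obtain ⟨e, he⟩ := e
  obtain ⟨φ, rfl, hφ⟩ := exists_edge_eq_of_col hc hd he
  rw [faceOfEdge_edge hc hd hφ, Subtype.mk.injEq]
  exact mem_faceEdges_iff hc (hφ.trans hf.symm)

variable (h3 : L.ThreeValent) (hc : L.ProperColoring col) (hd : d ≠ c)

/-- The flag at the vertex `v` on its face of color `c` and on its edge avoiding the color `d`. -/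
def flag (v : V) : Φ := (exists_flag h3 hc hd v).choose

lemma vert_flag (v : V) : L.vert (flag h3 hc hd v) = v := (exists_flag h3 hc hd v).choose_spec.1

lemma col_flag (v : V) : col (L.face (flag h3 hc hd v)) = c :=
  (exists_flag h3 hc hd v).choose_spec.2.1

lemma avoids_flag (v : V) : L.Avoids col d (L.edge (flag h3 hc hd v)) :=
  (exists_flag h3 hc hd v).choose_spec.2.2

lemma flag_vert {φ : Φ} (hφ : col (L.face φ) = c) (ha : L.Avoids col d (L.edge φ)) :
    flag h3 hc hd (L.vert φ) = φ := by
  rcases flags_of_vert_of_col h3 hc (vert_flag h3 hc hd (L.vert φ))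
    ((col_flag h3 hc hd _).trans hφ.symm) with h | h
  · exact h
  · have h' := avoids_flag h3 hc hd (L.vert φ)
    rw [h, avoids_τ1_iff h3 hc d φ (hφ.trans_ne hd.symm)] at h'
    exact absurd ha h'

/-- The other end of the edge of `flag h3 hc hd v`. -/
def opp (v : V) : V := L.vert (L.τ0 (flag h3 hc hd v))

lemma flag_opp (v : V) : flag h3 hc hd (opp h3 hc hd v) = L.τ0 (flag h3 hc hd v) :=
  flag_vert h3 hc hd ((congrArg col (L.face_τ0 _)).trans (col_flag h3 hc hd v))
    (by rw [L.edge_τ0]; exact avoids_flag h3 hc hd v)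

lemma opp_vert {φ : Φ} (hφ : col (L.face φ) = c) (ha : L.Avoids col d (L.edge φ)) :
    opp h3 hc hd (L.vert φ) = L.vert (L.τ0 φ) := by
  rw [opp, flag_vert h3 hc hd hφ ha]

lemma opp_ne (v : V) : opp h3 hc hd v ≠ v := by
  intro h
  have h' := flag_opp h3 hc hd v
  rw [h] at h'
  exact L.τ0_ne _ h'.symm

/-- The edge avoiding the color `d` that leaves the vertex `v` along its face of color `c`. -/
def edgeAt (v : V) : {e : E // L.Avoids col d e} :=
  ⟨L.edge (flag h3 hc hd v), avoids_flag h3 hc hd v⟩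

lemma edgeAt_eq_iff (u v : V) : edgeAt h3 hc hd u = edgeAt h3 hc hd v ↔
    u = v ∨ u = opp h3 hc hd v := by
  rw [edgeAt, edgeAt, Subtype.mk.injEq]
  constructor
  · intro h
    rw [← vert_flag h3 hc hd u, opp]
    rcases flags_of_edge_of_col hc h ((col_flag h3 hc hd u).trans (col_flag h3 hc hd v).symm)
      with h | h
    · exact Or.inl (by rw [h, vert_flag])
    · exact Or.inr (by rw [h])
  · rintro (rfl | rfl)
    · rfl
    · rw [flag_opp, L.edge_τ0]

lemma exists_edgeAt (e : {e : E // L.Avoids col d e}) : ∃ v, edgeAt h3 hc hd v = e := by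
  obtain ⟨e, he⟩ := e
  obtain ⟨φ, rfl, hφ⟩ := exists_edge_eq_of_col hc hd he
  exact ⟨L.vert φ, Subtype.ext (congrArg L.edge (flag_vert h3 hc hd hφ he))⟩

lemma faceOfEdge_edgeAt (v : V) :
    faceOfEdge hc hd (edgeAt h3 hc hd v) = faceOfVert h3 hc c v := by
  rw [edgeAt, faceOfEdge_edge hc hd (col_flag h3 hc hd v), ← faceOfVert_vert h3 hc, vert_flag]

lemma edgeAt_mem_boundary_iff {f : F} (hf : col f ≠ d) (v : V) :
    edgeAt h3 hc hd v ∈ (L.shrink col h3 hc d).boundary ⟨f, hf⟩ ↔ v ∈ L.faceVerts f := by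
  refine ((L.shrink col h3 hc d).mem_boundary_iff
    ⟨flag h3 hc hd v, avoids_flag h3 hc hd v⟩ ⟨f, hf⟩).trans ?_
  have hv := vert_flag h3 hc hd v
  have hφ := col_flag h3 hc hd v
  have hφ' := ((avoids_iff d _).1 (avoids_flag h3 hc hd v)).2
  have hne := hc (flag h3 hc hd v)
  simp only [shrink, Subtype.mk.injEq]
  generalize flag h3 hc hd v = φ at *
  subst hv
  by_cases hfc : col f = c
  · have hτ2 : L.face (L.τ2 φ) ≠ f := by grind
    rw [mem_faceVerts_iff h3 hc (hφ.trans hfc.symm)]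
    tauto
  · have hcol : col (L.face (L.τ2 φ)) = col f :=
      color_eq_of_ne hd (hφ ▸ hne.symm) hφ' hfc hf
    have hφf : L.face φ ≠ f := by grind
    rw [← L.vert_τ2 φ, mem_faceVerts_iff h3 hc hcol]
    tauto

lemma mem_faceVerts_iff_opp {f : F} (hf : col f ≠ d) (v : V) :
    v ∈ L.faceVerts f ↔ opp h3 hc hd v ∈ L.faceVerts f := by
  rw [← edgeAt_mem_boundary_iff h3 hc hd hf, ← edgeAt_mem_boundary_iff h3 hc hd hf,
    (edgeAt_eq_iff h3 hc hd (opp h3 hc hd v) v).2 (Or.inr rfl)]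

lemma edgeAt_mem_coboundary_iff {f : F} (hf : col f = d) (v : V) :
    edgeAt h3 hc hd v ∈ (L.shrink col h3 hc d).coboundary ⟨f, hf⟩ ↔
      ¬ (v ∈ L.faceVerts f ↔ opp h3 hc hd v ∈ L.faceVerts f) := by
  have hmem (u : V) : u ∈ L.faceVerts f ↔ L.face (L.τ2 (L.τ1 (flag h3 hc hd u))) = f := by
    have hcol := (avoids_iff_third h3 hc d _).1 (avoids_flag h3 hc hd u)
    rw [← mem_faceVerts_iff h3 hc (hcol.trans hf.symm), L.vert_τ2, L.vert_τ1, vert_flag]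
  refine ((L.shrink col h3 hc d).mem_coboundary_iff
    ⟨flag h3 hc hd v, avoids_flag h3 hc hd v⟩ ⟨f, hf⟩).trans ?_
  rw [hmem, hmem, flag_opp]
  simp only [shrink, Subtype.mk.injEq]

lemma mem_boundary_iff_faceOfEdge {f : F} (hf : col f = c) (e : {e : E // L.Avoids col d e}) :
    e ∈ (L.shrink col h3 hc d).boundary ⟨f, hf.trans_ne hd.symm⟩ ↔
      faceOfEdge hc hd e = ⟨f, hf⟩ := by
  obtain ⟨v, rfl⟩ := exists_edgeAt h3 hc hd e
  rw [edgeAt_mem_boundary_iff, faceOfEdge_edgeAt, mem_faceVerts_iff_faceOfVert h3 hc hf]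

end Flag

end Lattice

/-! ### Images of products of `X` and of `Z` -/

section PauliUnits

variable {Q R : Type*} [Fintype Q] [Fintype R]

lemma onSet_empty (P : Matrix (Fin 2) (Fin 2) ℂ) : onSet P (∅ : Set Q) = 1 := by
  simp [onSet, tensorPow_one]

lemma tensor_onSet (P : Matrix (Fin 2) (Fin 2) ℂ) (S : Set Q) (T : Set R) :
    tensor (onSet P S) (onSet P T) = onSet P (Sum.inl '' S ∪ Sum.inr '' T) := by
  ext x y
  simp only [tensor, onSet, tensorPow, Matrix.of_apply, Fintype.prod_sum_type]
  congr! 4 <;> simp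

lemma tensor_onSet_one (P : Matrix (Fin 2) (Fin 2) ℂ) (S : Set Q) :
    tensor (onSet P S) (1 : Op R R) = onSet P (Sum.inl '' S) := by
  rw [← onSet_empty P, tensor_onSet, Set.image_empty, Set.union_empty]

lemma tensor_one_onSet (P : Matrix (Fin 2) (Fin 2) ℂ) (T : Set R) :
    tensor (1 : Op Q Q) (onSet P T) = onSet P (Sum.inr '' T) := by
  rw [← onSet_empty P, tensor_onSet, Set.image_empty, Set.empty_union]

variable [DecidableEq Q]

/-- `pauliX s` as an invertible operator. -/
def unitX (s : Q → Fin 2) : (Op Q Q)ˣ :=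
  ⟨pauliX s, pauliX s, pauliX_mul_self s, pauliX_mul_self s⟩

/-- `pauliZ r` as an invertible operator. -/
def unitZ (r : Q → Fin 2) : (Op Q Q)ˣ :=
  ⟨pauliZ r, pauliZ r, pauliZ_mul_self r, pauliZ_mul_self r⟩

lemma XOn_eq_unitX (S : Set Q) : XOn S = unitX (S.indicator 1) := Units.ext (onSet_σX S)

lemma ZOn_eq_unitZ (S : Set Q) : ZOn S = unitZ (S.indicator 1) := Units.ext (onSet_σZ S)

lemma unitZ_zero : unitZ (0 : Q → Fin 2) = 1 := Units.ext pauliZ_zero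

lemma unitZ_add (r s : Q → Fin 2) : unitZ (r + s) = unitZ r * unitZ s :=
  Units.ext (pauliZ_add r s)

end PauliUnits

namespace CycleSystem

variable {V Q K : Type*} [Fintype Q] [DecidableEq Q] [Fintype K] (S : CycleSystem V Q K)

lemma unitZ_rootSum_mem {H : Subgroup (Op Q Q)ˣ} {i : Bool} (h : ∀ k, ZOn (S.edges i k) ∈ H)
    (s : V → Fin 2) : unitZ (S.rootSum i s) ∈ H := by
  refine Finset.sum_induction _ (unitZ · ∈ H)
    (fun r s hr hs => by rw [unitZ_add]; exact H.mul_mem hr hs)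
    (by rw [unitZ_zero]; exact H.one_mem) fun k _ => ?_
  generalize s (S.root k) = a
  fin_cases a
  · simp [unitZ_zero]
  · simpa [ZOn_eq_unitZ] using h k

variable [Fintype V] [DecidableEq V]

/-- Conjugation by `S.unitary`. -/
def conj : (Op V V)ˣ →* (Op Q Q)ˣ :=
  conjHom S.unitary S.unitary_mul_conjTranspose S.conjTranspose_mul_unitary

/-- If the sums along the edges of one kind vanish, then so does the parity of `s` on every
component, and no correction is needed. -/
lemma conj_unitX {s : V → Fin 2} (i : Bool) (h : ∀ v, S.δ s (S.edgeAt i v) = 0) :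
    S.conj (unitX s) = unitZ (S.rootSum true s) * unitX (S.δ s) := by
  have hi : S.parity (S.δ s) i = 0 := funext fun k => Finset.sum_eq_zero fun q _ => by
    obtain ⟨j, v, rfl⟩ := S.exists_edgeAt q
    by_cases hj : j = i
    · rw [hj, h, mul_zero]
    · rw [Set.indicator_of_notMem fun hq => hj (S.edgeAt_mem_edges.1 hq).1, zero_mul]
  have hp : S.parity (S.δ s) = 0 := funext fun j => by
    rw [S.parity_δ, ← S.parity_δ s i, hi, Pi.zero_apply]
  have hcompat : S.Compat (S.δ s) s := by
    rw [Compat, hp]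
    simp [corr]
  exact conjHom_eq (S.unitary_mul_pauliX_of_parity_eq_zero hcompat (congrFun hp true))

lemma conj_XOn {i : Bool} {T : Set V} {B : Set Q} (hB : ∀ q ∈ B, S.kind q = i)
    (hi : ∀ v, S.edgeAt i v ∈ B ↔ ¬ (v ∈ T ↔ S.opp i v ∈ T))
    (hT : ∀ v, v ∈ T ↔ S.opp (!i) v ∈ T) :
    S.conj (XOn T) = unitZ (S.rootSum true (T.indicator 1)) * XOn B := by
  classical
  have hδ : S.δ (T.indicator 1) = B.indicator 1 := by
    funext q
    obtain ⟨j, v, rfl⟩ := S.exists_edgeAt q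
    rw [S.δ_edgeAt]
    rcases Bool.eq_or_eq_not j i with rfl | rfl
    · by_cases h₁ : v ∈ T <;> by_cases h₂ : S.opp j v ∈ T <;>
        simp [hi, h₁, h₂, CharTwo.add_self_eq_zero]
    · have hv : S.edgeAt (!i) v ∉ B := fun hv => by simpa [S.kind_edgeAt] using hB _ hv
      simp only [Set.indicator_apply, hv, ← hT v, if_false]
      exact CharTwo.add_self_eq_zero _
  have h0 (v : V) : S.δ (T.indicator 1) (S.edgeAt (!i) v) = 0 := by
    rw [hδ, Set.indicator_of_notMem fun hv => by simpa [S.kind_edgeAt] using hB _ hv]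
  rw [XOn_eq_unitX, S.conj_unitX _ h0, hδ, ← XOn_eq_unitX]

lemma conj_XOn_vcomp (k : K) : S.conj (XOn (S.vcomp ⁻¹' {k})) = ZOn (S.edges true k) := by
  classical
  have hroot : S.rootSum true ((S.vcomp ⁻¹' {k}).indicator 1) = (S.edges true k).indicator 1 := by
    simp [rootSum, Set.indicator_apply, S.vcomp_root]
  have hX : XOn (∅ : Set Q) = 1 := Units.ext (onSet_empty σX)
  rw [S.conj_XOn (i := true) (B := ∅) (by simp) (by simp [S.vcomp_opp]) (by simp [S.vcomp_opp]),
    hroot, hX, mul_one, ZOn_eq_unitZ]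

lemma conj_ZOn {i : Bool} {B : Set Q} (hB : ∀ q ∈ B, S.kind q = i) :
    S.conj (ZOn (S.edgeAt i ⁻¹' B)) =
      ZOn B * unitZ (S.rootSum (!i) ((S.edgeAt i ⁻¹' B).indicator 1)) := by
  have h (j : Bool) (hj : j ≠ i) : (B.indicator 1 ∘ S.edgeAt j : V → Fin 2) = 0 := funext fun v =>
    Set.indicator_of_notMem (fun hv => hj ((S.kind_edgeAt j v).symm.trans (hB _ hv))) _
  have hcomp : (B.indicator 1 ∘ S.edgeAt i : V → Fin 2) = (S.edgeAt i ⁻¹' B).indicator 1 := rfl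
  have hvertex : S.vertexSum (B.indicator 1) = (S.edgeAt i ⁻¹' B).indicator 1 := funext fun v =>
    Finset.sum_eq_single i (fun j _ hj => congrFun (h j hj) v) (by simp)
  have hroot : ∑ j, S.rootSum (!j) (B.indicator 1 ∘ S.edgeAt j) =
      S.rootSum (!i) ((S.edgeAt i ⁻¹' B).indicator 1) := by
    rw [← hcomp]
    exact Finset.sum_eq_single i (fun j _ hj => by rw [h j hj]; simp [rootSum]) (by simp)
  rw [ZOn_eq_unitZ, ZOn_eq_unitZ, ← unitZ_add, ← hroot, ← hvertex]
  exact conjHom_eq (S.unitary_mul_pauliZ_vertexSum _)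

end CycleSystem

/-! ### Generators of the stabilizer groups -/

section Generators

variable {V E F Φ V' E' F' Φ' : Type*} {G : Type*} [Group G]

lemma map_colorCode_le_iff [Fintype V] [DecidableEq V] (L : Lattice V E F Φ)
    (h : (Op V V)ˣ →* G) (J : Subgroup G) :
    (colorCode L).map h ≤ J ↔
      (∀ f, h (XOn (L.faceVerts f)) ∈ J) ∧ ∀ f, h (ZOn (L.faceVerts f)) ∈ J := by
  simp [colorCode, Subgroup.map_le_iff_le_comap, Set.range_subset_iff]

lemma map_toricCode_le_iff [Fintype E] [DecidableEq E] (L : Lattice V E F Φ)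
    (h : (Op E E)ˣ →* G) (J : Subgroup G) :
    (toricCode L).map h ≤ J ↔
      (∀ v, h (XOn (L.coboundary v)) ∈ J) ∧ ∀ f, h (ZOn (L.boundary f)) ∈ J := by
  simp [toricCode, Subgroup.map_le_iff_le_comap, Set.range_subset_iff]

lemma map_tensorHom_toricCode_le_iff [Fintype E] [DecidableEq E] [Fintype E'] [DecidableEq E']
    (L : Lattice V E F Φ) (M : Lattice V' E' F' Φ') (J : Subgroup (Op (E ⊕ E') (E ⊕ E'))ˣ) :
    ((toricCode L).prod (toricCode M)).map tensorHom ≤ J ↔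
      ((∀ v, XOn (Sum.inl '' L.coboundary v) ∈ J) ∧ ∀ f, ZOn (Sum.inl '' L.boundary f) ∈ J) ∧
      (∀ v, XOn (Sum.inr '' M.coboundary v) ∈ J) ∧ ∀ f, ZOn (Sum.inr '' M.boundary f) ∈ J := by
  have hXl (S : Set E) : tensorHom (XOn S, (1 : (Op E' E')ˣ)) = XOn (Sum.inl '' S) :=
    Units.ext (tensor_onSet_one σX S)
  have hZl (S : Set E) : tensorHom (ZOn S, (1 : (Op E' E')ˣ)) = ZOn (Sum.inl '' S) :=
    Units.ext (tensor_onSet_one σZ S)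
  have hXr (S : Set E') : tensorHom ((1 : (Op E E)ˣ), XOn S) = XOn (Sum.inr '' S) :=
    Units.ext (tensor_one_onSet σX S)
  have hZr (S : Set E') : tensorHom ((1 : (Op E E)ˣ), ZOn S) = ZOn (Sum.inr '' S) :=
    Units.ext (tensor_one_onSet σZ S)
  rw [Subgroup.map_le_iff_le_comap, Subgroup.prod_le_iff, map_toricCode_le_iff,
    map_toricCode_le_iff]
  simp only [Subgroup.mem_comap, MonoidHom.inl_apply, MonoidHom.inr_apply, hXl, hZl, hXr, hZr]

end Generators

namespace Lattice

/-! ### The cycles around the faces of color `C` -/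

/-- The color of the faces that are shrunk to obtain the lattices `L_A` (`true`) and `L_B`
(`false`). -/
def shrunkColor : Bool → Color
  | true => Color.A
  | false => Color.B

lemma shrunkColor_ne_C (i : Bool) : shrunkColor i ≠ Color.C := by cases i <;> decide

lemma shrunkColor_injective : Function.Injective shrunkColor := by decide

lemma eq_C_or_exists_eq_shrunkColor (c : Color) : c = Color.C ∨ ∃ i, c = shrunkColor i := by
  cases c
  exacts [Or.inr ⟨true, rfl⟩, Or.inr ⟨false, rfl⟩, Or.inl rfl]

lemma exists_ne_shrunkColor (c : Color) : ∃ i, c ≠ shrunkColor i := by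
  by_cases h : c = Color.A
  exacts [⟨false, by rw [h]; decide⟩, ⟨true, h⟩]

variable {V E F Φ : Type*} {L : Lattice V E F Φ} {col : F → Color}

/-- The qubit on an edge of `L_A` or of `L_B`. -/
def qubit : ∀ i : Bool, {e : E // L.Avoids col (shrunkColor i) e} → ToricQubits L col
  | true => Sum.inl
  | false => Sum.inr

lemma qubit_injective : ∀ i, Function.Injective (qubit (L := L) (col := col) i)
  | true => Sum.inl_injective
  | false => Sum.inr_injective

lemma exists_qubit (q : ToricQubits L col) : ∃ i e, qubit i e = q := by
  rcases q with e | e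
  exacts [⟨true, e, rfl⟩, ⟨false, e, rfl⟩]

variable (h3 : L.ThreeValent) (hc : L.ProperColoring col)

lemma reachable_of_face_eq {φ ψ : Φ} (hφ : col (L.face φ) = Color.C)
    (h : L.face φ = L.face ψ) :
    Relation.ReflTransGen (fun u w => ∃ i, w = opp h3 hc (shrunkColor_ne_C i) u)
      (L.vert φ) (L.vert ψ) := by
  have hψ : SameOrbit L.τ0 L.τ1 φ ψ := (L.face_eq_iff φ ψ).1 h
  clear h
  induction hψ with
  | refl => exact Relation.ReflTransGen.refl
  | @tail χ _ hχ hstep ih =>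
    rcases hstep with rfl | rfl
    · have hcol : col (L.face χ) = Color.C := by rwa [← (L.face_eq_iff φ χ).2 hχ]
      refine ih.tail ?_
      rcases avoids_or_avoids (shrunkColor_ne_C true) (shrunkColor_ne_C false)
        (shrunkColor_injective.ne (by decide)) hcol with ha | ha
      exacts [⟨true, (opp_vert h3 hc _ hcol ha).symm⟩, ⟨false, (opp_vert h3 hc _ hcol ha).symm⟩]
    · rwa [L.vert_τ1]

/-- The cycles around the faces of color `C`.  Their vertices are all the vertices of the lattice,
their edges are the `BC` edges (kind `true`) and the `AC` edges (kind `false`). -/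
def cycles : CycleSystem V (ToricQubits L col) {f : F // col f = Color.C} where
  edgeAt i v := qubit i (edgeAt h3 hc (shrunkColor_ne_C i) v)
  opp i := opp h3 hc (shrunkColor_ne_C i)
  root f := L.vert (L.face_surj f.1).choose
  kind q := q.isLeft
  comp := Sum.elim (faceOfEdge hc (shrunkColor_ne_C true)) (faceOfEdge hc (shrunkColor_ne_C false))
  vcomp := faceOfVert h3 hc Color.C
  kind_edgeAt i _ := by cases i <;> rfl
  comp_edgeAt i v := by cases i <;> exact faceOfEdge_edgeAt h3 hc _ v
  exists_edgeAt q := by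
    obtain ⟨i, e, rfl⟩ := exists_qubit q
    obtain ⟨v, rfl⟩ := exists_edgeAt h3 hc (shrunkColor_ne_C i) e
    exact ⟨i, v, rfl⟩
  opp_ne i := opp_ne h3 hc (shrunkColor_ne_C i)
  edgeAt_eq_iff i u v := (qubit_injective i).eq_iff.trans (edgeAt_eq_iff h3 hc _ u v)
  vcomp_root f := by
    have hf := (L.face_surj f.1).choose_spec
    rw [faceOfVert_vert h3 hc ((congrArg col hf).trans f.2)]
    exact Subtype.ext hf
  reachable v := by
    obtain ⟨φ, rfl, hφ⟩ := exists_vert_eq_of_col h3 hc Color.C v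
    have hroot := (L.face_surj (L.face φ)).choose_spec
    rw [faceOfVert_vert h3 hc hφ]
    exact reachable_of_face_eq h3 hc ((congrArg col hroot).trans hφ) hroot

lemma kind_qubit (i : Bool) (e : {e : E // L.Avoids col (shrunkColor i) e}) :
    (cycles h3 hc).kind (qubit i e) = i := by
  cases i <;> rfl

lemma comp_qubit (i : Bool) (e : {e : E // L.Avoids col (shrunkColor i) e}) :
    (cycles h3 hc).comp (qubit i e) = faceOfEdge hc (shrunkColor_ne_C i) e := by
  cases i <;> rfl

lemma mem_faceVerts_iff_vcomp {f : F} (hf : col f = Color.C) (v : V) :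
    v ∈ L.faceVerts f ↔ (cycles h3 hc).vcomp v = ⟨f, hf⟩ :=
  mem_faceVerts_iff_faceOfVert h3 hc hf v

lemma mem_faceEdges_iff_comp {f : F} (hf : col f = Color.C) (q : ToricQubits L col) :
    ToricQubits.edge q ∈ L.faceEdges f ↔ (cycles h3 hc).comp q = ⟨f, hf⟩ := by
  rcases q with e | e
  exacts [mem_faceEdges_iff_faceOfEdge hc (shrunkColor_ne_C true) hf e,
    mem_faceEdges_iff_faceOfEdge hc (shrunkColor_ne_C false) hf e]

lemma edges_cycles (i : Bool) (f : {f : F // col f = Color.C}) : (cycles h3 hc).edges i f =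
    qubit i '' (L.shrink col h3 hc (shrunkColor i)).boundary
      ⟨f.1, f.2.trans_ne (shrunkColor_ne_C i).symm⟩ := by
  ext q
  constructor
  · rintro ⟨hi, hq⟩
    obtain ⟨j, e, rfl⟩ := exists_qubit q
    obtain rfl : j = i := (kind_qubit h3 hc j e).symm.trans hi
    exact ⟨e, (mem_boundary_iff_faceOfEdge h3 hc _ f.2 e).2 ((comp_qubit h3 hc j e).symm.trans hq),
      rfl⟩
  · rintro ⟨e, he, rfl⟩
    exact ⟨kind_qubit h3 hc i e, (comp_qubit h3 hc i e).trans
      ((mem_boundary_iff_faceOfEdge h3 hc _ f.2 e).1 he)⟩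

/-! ### Images of the generators of the color code -/

variable [DecidableEq E] [Fintype {e : E // L.Avoids col Color.A e}]
  [Fintype {e : E // L.Avoids col Color.B e}]

/-- The group of operators `S ⊗ T` with `S`, `T` in the stabilizer groups of the two toric codes. -/
def toricGroup : Subgroup (Op (ToricQubits L col) (ToricQubits L col))ˣ :=
  ((toricCode (L.shrink col h3 hc Color.A)).prod
    (toricCode (L.shrink col h3 hc Color.B))).map tensorHom

lemma toricGroup_le_iff (J : Subgroup (Op (ToricQubits L col) (ToricQubits L col))ˣ) :
    toricGroup h3 hc ≤ J ↔
      ∀ i, (∀ f, XOn (qubit i '' (L.shrink col h3 hc (shrunkColor i)).coboundary f) ∈ J) ∧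
        ∀ f, ZOn (qubit i '' (L.shrink col h3 hc (shrunkColor i)).boundary f) ∈ J := by
  rw [Bool.forall_bool, and_comm]
  exact map_tensorHom_toricCode_le_iff _ _ J

variable [Fintype V] [DecidableEq V] [Fintype {f : F // col f = Color.C}]

lemma conj_XOn_of_col_eq_shrunkColor {i : Bool} {f : F} (hf : col f = shrunkColor i) :
    (cycles h3 hc).conj (XOn (L.faceVerts f)) =
      unitZ ((cycles h3 hc).rootSum true ((L.faceVerts f).indicator 1)) *
        XOn (qubit i '' (L.shrink col h3 hc (shrunkColor i)).coboundary ⟨f, hf⟩) := by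
  refine (cycles h3 hc).conj_XOn (i := i) ?_ (fun v => ?_) fun v => ?_
  · rintro _ ⟨e, _, rfl⟩
    exact kind_qubit h3 hc i e
  · exact (qubit_injective i).mem_set_image.trans (edgeAt_mem_coboundary_iff h3 hc _ hf v)
  · have hf' : col f ≠ shrunkColor (!i) := hf.trans_ne (shrunkColor_injective.ne (by simp))
    exact mem_faceVerts_iff_opp h3 hc _ hf' v

lemma conj_XOn_of_col_eq_C (f : {f : F // col f = Color.C}) :
    (cycles h3 hc).conj (XOn (L.faceVerts f.1)) = ZOn ((cycles h3 hc).edges true f) := by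
  rw [← (cycles h3 hc).conj_XOn_vcomp f]
  exact congrArg _ (congrArg _ (Set.ext (mem_faceVerts_iff_vcomp h3 hc f.2)))

lemma conj_ZOn_of_col_ne_shrunkColor {i : Bool} {f : F} (hf : col f ≠ shrunkColor i) :
    (cycles h3 hc).conj (ZOn (L.faceVerts f)) =
      ZOn (qubit i '' (L.shrink col h3 hc (shrunkColor i)).boundary ⟨f, hf⟩) *
        unitZ ((cycles h3 hc).rootSum (!i) ((L.faceVerts f).indicator 1)) := by
  have hB : ∀ q ∈ qubit i '' (L.shrink col h3 hc (shrunkColor i)).boundary ⟨f, hf⟩,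
      (cycles h3 hc).kind q = i := by
    rintro _ ⟨e, _, rfl⟩
    exact kind_qubit h3 hc i e
  have hverts : (cycles h3 hc).edgeAt i ⁻¹'
      (qubit i '' (L.shrink col h3 hc (shrunkColor i)).boundary ⟨f, hf⟩) = L.faceVerts f :=
    Set.ext fun v => (qubit_injective i).mem_set_image.trans (edgeAt_mem_boundary_iff h3 hc _ hf v)
  rw [← hverts]
  exact (cycles h3 hc).conj_ZOn hB

lemma map_colorCode_le : (colorCode L).map (cycles h3 hc).conj ≤ toricGroup h3 hc := by
  have hgen := (toricGroup_le_iff h3 hc _).1 le_rfl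
  have hedges (i : Bool) (f) : ZOn ((cycles h3 hc).edges i f) ∈ toricGroup h3 hc := by
    rw [edges_cycles]
    exact (hgen i).2 _
  rw [map_colorCode_le_iff]
  refine ⟨fun f => ?_, fun f => ?_⟩
  · rcases eq_C_or_exists_eq_shrunkColor (col f) with hf | ⟨i, hf⟩
    · rw [conj_XOn_of_col_eq_C h3 hc ⟨f, hf⟩]
      exact hedges true _
    · rw [conj_XOn_of_col_eq_shrunkColor h3 hc hf]
      exact mul_mem ((cycles h3 hc).unitZ_rootSum_mem (hedges true) _) ((hgen i).1 _)
  · obtain ⟨i, hf⟩ := exists_ne_shrunkColor (col f)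
    rw [conj_ZOn_of_col_ne_shrunkColor h3 hc hf]
    exact mul_mem ((hgen i).2 _) ((cycles h3 hc).unitZ_rootSum_mem (hedges _) _)

/-- The factors at the roots are removed step by step: the `X` generators of the `C` faces give the
edges of kind `true`, hence the `Z` generators of `L_B`, hence the edges of kind `false`, hence the
`Z` generators of `L_A`. -/
lemma le_map_colorCode : toricGroup h3 hc ≤ (colorCode L).map (cycles h3 hc).conj := by
  obtain ⟨hX, hZ⟩ := (map_colorCode_le_iff L (cycles h3 hc).conj _).1 le_rfl
  set H := (colorCode L).map (cycles h3 hc).conj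
  have hboundary {i : Bool} (h : ∀ f, ZOn ((cycles h3 hc).edges (!i) f) ∈ H) (f) :
      ZOn (qubit i '' (L.shrink col h3 hc (shrunkColor i)).boundary f) ∈ H := by
    have hf := hZ f.1
    rw [conj_ZOn_of_col_ne_shrunkColor h3 hc f.2] at hf
    exact (H.mul_mem_cancel_right ((cycles h3 hc).unitZ_rootSum_mem h _)).1 hf
  have htrue (f) : ZOn ((cycles h3 hc).edges true f) ∈ H := by
    rw [← conj_XOn_of_col_eq_C]
    exact hX f.1
  have hfalse (f) : ZOn ((cycles h3 hc).edges false f) ∈ H := by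
    rw [edges_cycles]
    exact hboundary (i := false) htrue _
  refine (toricGroup_le_iff h3 hc _).2 fun i => ⟨fun f => ?_, ?_⟩
  · have hf := hX f.1
    rw [conj_XOn_of_col_eq_shrunkColor h3 hc f.2] at hf
    exact (H.mul_mem_cancel_left ((cycles h3 hc).unitZ_rootSum_mem htrue _)).1 hf
  · cases i
    exacts [hboundary htrue, hboundary hfalse]

end Lattice

end ColorCode

end

open ColorCode in
open scoped Classical in
theorem theorem1 {V E F Φ : Type*} [Fintype V] [Fintype E] [Fintype F] [Fintype Φ]
    (L : Lattice V E F Φ) (h3 : L.ThreeValent)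
    (col : F → Color) (hc : L.ProperColoring col) :
    ∃ U_ : ∀ f : {f : F // col f = Color.C}, Op (EdgesOn L col f.1) (VertsOn L f.1),
      (∀ f, IsClifford (U_ f)) ∧
      ∃ U : Op (ToricQubits L col) V,
        U = tensorOverC L col U_ ∧
        IsClifford U ∧
        {T | ∃ M ∈ ops (colorCode L), T = U * M * U.conjTranspose} =
          tensorGroup (toricCode (L.shrink col h3 hc Color.A))
            (toricCode (L.shrink col h3 hc Color.B)) := by
  refine ⟨fun f => ((Lattice.cycles h3 hc).restrict f (Lattice.mem_faceVerts_iff_vcomp h3 hc f.2)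
      (Lattice.mem_faceEdges_iff_comp h3 hc f.2)).unitary,
    fun f => CycleSystem.isClifford_unitary _, (Lattice.cycles h3 hc).unitary, ?_,
    CycleSystem.isClifford_unitary _, ?_⟩
  · ext x y
    exact (Lattice.cycles h3 hc).unitary_eq_prod
      (fun f => Lattice.mem_faceVerts_iff_vcomp h3 hc f.2)
      (fun f => Lattice.mem_faceEdges_iff_comp h3 hc f.2) x y
  · rw [tensorGroup_eq]
    exact (conj_ops_eq _ (Lattice.cycles h3 hc).unitary_mul_conjTranspose
      (Lattice.cycles h3 hc).conjTranspose_mul_unitary _).trans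
      (congrArg ops (le_antisymm (Lattice.map_colorCode_le h3 hc) (Lattice.le_map_colorCode h3 hc)))
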